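/- Let $f:\mathbb{R}^n\to\mathbb{R}$ and $G:\mathbb{R}^n\to\mathbb{S}^m$ be twice continuously differentiable, where $\mathbb{S}^m$ is the space of real symmetric $m\times m$ matrices with inner product $\langle A,B\rangle=\operatorname{tr}(AB)$ (for not necessarily symmetric matrices, $\langle A,B\rangle=\operatorname{tr}(A^TB)$) and $\mathbb{S}^m_+$ is the cone of positive semidefinite matrices. Consider the problem (NSDP) of minimizing $f(x)$ subject to $G(x)\in\mathbb{S}^m_+$, with feasible set $\Omega$. For $\bar x\in\Omega$ write $\mathcal{T}_S(z)$ for the Bouligand tangent cone to $S$ at $z$ and put $$\mathcal{L}_\Omega(\bar x)=\{d\mid DG(\bar x)d\in\mathcal{T}_{\mathbb{S}^m_+}(G(\bar x))\},\qquad C(\bar x)=\{d\in\mathcal{T}_\Omega(\bar x)\mid \langle\nabla f(\bar x),d\rangle=0\}.$$ Let $\Lambda(\bar x)$ be the set of Lagrange multipliers, i.e. of the $\bar\lambda\in\mathbb{S}^m$ with $\langle\bar\lambda,Y\rangle\le 0$ for all $Y\in\mathbb{S}^m_+$, $\nabla f(\bar x)+DG(\bar x)^T\bar\lambda=0$ and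 $\langle G(\bar x),\bar\lambda\rangle=0$. Let $$\sigma(d,\bar x,\bar\lambda)=\sup\{\langle w,\bar\lambda\rangle\mid w\in\mathcal{T}^2_{\mathbb{S}^m_+}(G(\bar x),DG(\bar x)d)\},$$ where $\mathcal{T}^2_S(z,y)$ is the set of all $w$ with $z+ty+\tfrac{t^2}{2}w+o(t^2)\in S$ for all $t>0$. Let $r=\operatorname{rank}G(\bar x)$, let $\bar E\in\mathbb{R}^{m\times(m-r)}$ be any matrix whose columns form an orthonormal basis of $\operatorname{Ker}G(\bar x)$, and let $\mathcal{E}:\mathbb{S}^m\to\mathbb{R}^{m\times(m-r)}$ be any function, analytic near $G(\bar x)$, with $\mathcal{E}(G(\bar x))=\bar E$ and such that, for all $A$ near $G(\bar x)$, the columns of $\mathcal{E}(A)$ form an orthonormal basis of the space spanned by the eigenvectors associated with the $m-r$ smallest eigenvalues of $A$. Put $E(x)=\mathcal{E}(G(x))$ and $\mathcal{G}(x)=E(x)^TG(x)E(x)\in\mathbb{S}^{m-r}$. The facial constant rank property holds at $\bar x$ (for this choice of $\mathcal{E}$) if there is a neighborhood $\mathcal{V}$ of $\bar x$ such that, for each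 face $F$ of $\mathbb{S}^{m-r}_+$, the dimension of $D\mathcal{G}(x)^T[F^\perp]$ is constant for $x\in\mathcal{V}$. **Theorem.** Let $\bar x\in\Omega$ be a local minimizer of (NSDP) at which the facial constant rank property holds. Then $C(\bar x)=\mathcal{L}_\Omega(\bar x)\cap\{\nabla f(\bar x)\}^\perp$, and for every $\bar\lambda\in\Lambda(\bar x)$ and every $d\in C(\bar x)$, $$\sigma(d,\bar x,\bar\lambda)=d^T\mathcal{H}(\bar x,\bar\lambda)d,\qquad \mathcal{H}(\bar x,\bar\lambda)=\left[2\langle D_{x_i}G(\bar x)\,G(\bar x)^{\dagger}\,D_{x_j}G(\bar x),\bar\lambda\rangle\right]_{i,j=1,\dots,n},$$ where $G(\bar x)^\dagger$ is the Moore–Penrose pseudoinverse, and $$d^T\nabla^2 f(\bar x)d+\langle D^2G(\bar x)[d,d],\bar\lambda\rangle-\sigma(d,\bar x,\bar\lambda)\ge 0.$$ -/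

import Mathlib

open Filter Asymptotics Topology Matrix

-- Spaces of matrices carry the Frobenius norm.
attribute [local instance] Matrix.frobeniusNormedAddCommGroup Matrix.frobeniusNormedSpace

/-- The trace inner product `⟪A, B⟫ = tr (Aᵀ B)`, whose norm is the Frobenius norm. -/
noncomputable instance matrixTraceInner (a b : ℕ) :
    InnerProductSpace ℝ (Matrix (Fin a) (Fin b) ℝ) where
  inner A B := (Aᵀ * B).trace
  norm_sq_eq_re_inner A := by
    have h : (0 : ℝ) ≤ ∑ i, ∑ j, ‖A i j‖ ^ (2 : ℝ) :=
      Finset.sum_nonneg fun i _ => Finset.sum_nonneg fun j _ => by positivity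
    rw [Matrix.frobenius_norm_def, ← Real.rpow_natCast, ← Real.rpow_mul h]
    simp only [Matrix.trace, Matrix.mul_apply, Matrix.diag_apply, Matrix.transpose_apply]
    rw [Finset.sum_comm]
    simp [pow_two]
  conj_inner_symm A B := by
    simp only [Matrix.trace, Matrix.mul_apply, Matrix.diag_apply, Matrix.transpose_apply]
    simp [mul_comm]
  add_left A B C := by simp [Matrix.add_mul]
  smul_left A B c := by simp

namespace NSDP

/-- The space `𝕊^m` of real symmetric `m × m` matrices, with the trace inner product. -/
abbrev SymMat (m : ℕ) : Submodule ℝ (Matrix (Fin m) (Fin m) ℝ) where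
  carrier := {A | A.IsSymm}
  add_mem' hA hB := hA.add hB
  zero_mem' := Matrix.isSymm_zero
  smul_mem' c _ hA := hA.smul c

/-- Euclidean space `ℝ^n`. -/
abbrev Vec (n : ℕ) : Type := EuclideanSpace ℝ (Fin n)

theorem symMat_isHermitian {m : ℕ} (A : SymMat m) : A.1.IsHermitian := by
  have h : A.1ᵀ = A.1 := A.2
  rw [Matrix.IsHermitian, Matrix.conjTranspose_eq_transpose_of_trivial, h]

/-- The cone `𝕊^m_+` of positive semidefinite matrices. -/
def psdCone (m : ℕ) : Set (SymMat m) := {A | A.1.PosSemidef}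

section General

variable {E : Type*} [NormedAddCommGroup E] [InnerProductSpace ℝ E]

/-- The polar `S° = {z | ⟪z, y⟫ ≤ 0 for all y ∈ S}`. -/
def polarSet (S : Set E) : Set E := {z | ∀ y ∈ S, inner ℝ z y ≤ 0}

/-- The Bouligand tangent cone to `S` at `z`. -/
def tangentCone (S : Set E) (z : E) : Set E :=
  {y | ∃ (t : ℕ → ℝ) (v : ℕ → E), (∀ k, 0 < t k) ∧ Tendsto t atTop (𝓝 0) ∧
    Tendsto v atTop (𝓝 y) ∧ ∀ k, z + t k • v k ∈ S}

/-- The (inner) second-order tangent set to `S` at `z` in the direction `y`: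
the `w` with `z + t y + (t² / 2) w + o(t²) ∈ S` for all `t > 0`. -/
def secondTangentSet (S : Set E) (z y : E) : Set E :=
  {w | ∃ ρ : ℝ → E, ρ =o[𝓝[>] 0] (fun t : ℝ => t ^ 2) ∧
    ∀ t : ℝ, 0 < t → z + t • y + (t ^ 2 / 2) • w + ρ t ∈ S}

/-- Faces of a convex set: nonempty convex subsets that contain the end points of every open
segment of `C` which they meet. -/
def IsFace (C F : Set E) : Prop := F.Nonempty ∧ Convex ℝ F ∧ IsExtreme ℝ C F

/-- `D² g(x)[d, d]`. -/
noncomputable def secondDeriv {n : ℕ} (g : Vec n → E) (x d : Vec n) : E :=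
  fderiv ℝ (fderiv ℝ g) x d d

end General

/-- The Moore–Penrose pseudoinverse of a symmetric matrix: in an orthonormal basis of
eigenvectors, the nonzero eigenvalues are inverted and the zero ones are kept. -/
noncomputable def pinv {m : ℕ} (A : SymMat m) : Matrix (Fin m) (Fin m) ℝ :=
  ((symMat_isHermitian A).eigenvectorUnitary : Matrix (Fin m) (Fin m) ℝ) *
    Matrix.diagonal (fun i => ((symMat_isHermitian A).eigenvalues i)⁻¹) *
    ((symMat_isHermitian A).eigenvectorUnitary : Matrix (Fin m) (Fin m) ℝ)ᵀ

/-- `pinv A` satisfies the four Penrose equations. -/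
theorem pinv_penrose {m : ℕ} (A : SymMat m) :
    A.1 * pinv A * A.1 = A.1 ∧ pinv A * A.1 * pinv A = pinv A ∧
      (A.1 * pinv A).IsSymm ∧ (pinv A * A.1).IsSymm := by
  set U : Matrix (Fin m) (Fin m) ℝ := ((symMat_isHermitian A).eigenvectorUnitary).1 with hU
  set e := (symMat_isHermitian A).eigenvalues with he
  have hUU : Uᵀ * U = 1 := by
    have h := Unitary.coe_star_mul_self (symMat_isHermitian A).eigenvectorUnitary
    rwa [Matrix.star_eq_conjTranspose, Matrix.conjTranspose_eq_transpose_of_trivial] at h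
  have hA : A.1 = U * Matrix.diagonal e * Uᵀ := by
    have h := (symMat_isHermitian A).spectral_theorem
    rw [Unitary.conjStarAlgAut_apply, Matrix.star_eq_conjTranspose,
      Matrix.conjTranspose_eq_transpose_of_trivial] at h
    exact h
  have hP : pinv A = U * Matrix.diagonal (fun i => (e i)⁻¹) * Uᵀ := rfl
  have key : ∀ M N : Matrix (Fin m) (Fin m) ℝ,
      (U * M * Uᵀ) * (U * N * Uᵀ) = U * (M * N) * Uᵀ := by
    intro M N
    calc (U * M * Uᵀ) * (U * N * Uᵀ) = U * M * (Uᵀ * U) * N * Uᵀ := by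
          simp only [Matrix.mul_assoc]
      _ = U * (M * N) * Uᵀ := by rw [hUU]; simp only [Matrix.mul_assoc, Matrix.one_mul]
  have hsymm : ∀ v : Fin m → ℝ, (U * Matrix.diagonal v * Uᵀ).IsSymm := by
    intro v
    simp [Matrix.IsSymm, Matrix.transpose_mul, Matrix.mul_assoc]
  have h1 : (fun i => e i * (e i)⁻¹ * e i) = e := by
    funext i
    exact mul_inv_mul_cancel (e i)
  have h2 : (fun i => (e i)⁻¹ * e i * (e i)⁻¹) = fun i => (e i)⁻¹ := by
    funext i
    simpa only [inv_inv] using mul_inv_mul_cancel (e i)⁻¹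
  refine ⟨?_, ?_, ?_, ?_⟩
  · rw [hP, hA, key, key, Matrix.diagonal_mul_diagonal, Matrix.diagonal_mul_diagonal, h1]
  · rw [hP, hA, key, key, Matrix.diagonal_mul_diagonal, Matrix.diagonal_mul_diagonal, h2]
  · rw [hP, hA, key, Matrix.diagonal_mul_diagonal]
    exact hsymm _
  · rw [hP, hA, key, Matrix.diagonal_mul_diagonal]
    exact hsymm _

/-- The span of the eigenvectors of `A` belonging to the eigenvalues
`μ_{r+1}(A) ≥ ⋯ ≥ μ_m(A)`, all eigenvalues being listed in non-increasing order
(`eigenvalues₀` is this list, numbered from `0`). It is only used where `μ_r(A) > μ_{r+1}(A)`. -/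
noncomputable def lowEigenspace {m : ℕ} (A : SymMat m) (r : ℕ) : Submodule ℝ (Fin m → ℝ) :=
  ⨆ i : {i : Fin (Fintype.card (Fin m)) // r ≤ (i : ℕ)},
    Module.End.eigenspace (Matrix.toLin' A.1) ((symMat_isHermitian A).eigenvalues₀ i.1)

/-- The columns of `E` form an orthonormal basis of the subspace `S`. -/
def IsOrthonormalBasisMatrix {m k : ℕ} (E : Matrix (Fin m) (Fin k) ℝ)
    (S : Submodule ℝ (Fin m → ℝ)) : Prop :=
  Eᵀ * E = 1 ∧ Submodule.span ℝ (Set.range E.col) = S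

/-- `Ebar` is an orthonormal basis matrix of the kernel of `Abar`, and `𝓔` is an analytic extension
of it near `Abar`, whose values are orthonormal basis matrices of the space spanned by the
eigenvectors associated with the `m - r` smallest eigenvalues. Used with `r = rank Abar`. -/
structure IsEigenframe {m r : ℕ} (Abar : SymMat m) (Ebar : Matrix (Fin m) (Fin (m - r)) ℝ)
    (𝓔 : SymMat m → Matrix (Fin m) (Fin (m - r)) ℝ) : Prop where
  basis_ker : IsOrthonormalBasisMatrix Ebar (LinearMap.ker (Matrix.toLin' Abar.1))
  analyticAt : AnalyticAt ℝ 𝓔 Abar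
  apply_base : 𝓔 Abar = Ebar
  basis_low : ∀ᶠ A in 𝓝 Abar, IsOrthonormalBasisMatrix (𝓔 A) (lowEigenspace A r)

/-- `Eᵀ A E`. -/
def compress {m k : ℕ} (E : Matrix (Fin m) (Fin k) ℝ) (A : SymMat m) : SymMat k :=
  ⟨Eᵀ * A.1 * E, by
    have h : A.1ᵀ = A.1 := A.2
    change (Eᵀ * A.1 * E)ᵀ = Eᵀ * A.1 * E
    rw [Matrix.transpose_mul, Matrix.transpose_mul, h, Matrix.transpose_transpose,
      Matrix.mul_assoc]⟩

section Problem

variable {n m : ℕ}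

/-- The feasible set `Ω` of the constraint `G x ⪰ 0`. -/
def feasibleSet (G : Vec n → SymMat m) : Set (Vec n) := {x | G x ∈ psdCone m}

/-- The reduced constraint function `x ↦ E(x)ᵀ G(x) E(x)` with `E = 𝓔 ∘ G`. -/
def reducedConstraint {k : ℕ} (𝓔 : SymMat m → Matrix (Fin m) (Fin k) ℝ)
    (G : Vec n → SymMat m) (x : Vec n) : SymMat k :=
  compress (𝓔 (G x)) (G x)

/-- The adjoint `D g(x)ᵀ` of the derivative. -/
noncomputable def derivAdjoint {k : ℕ} (g : Vec n → SymMat k) (x : Vec n) :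
    SymMat k →ₗ[ℝ] Vec n :=
  LinearMap.adjoint (fderiv ℝ g x : Vec n →ₗ[ℝ] SymMat k)

/-- The facial constant rank property at `xbar`, for the reduced constraint function `g` with
values in `𝕊^k`: on a neighbourhood of `xbar`, the dimension of `D g(x)ᵀ [F^⊥]` is constant for
each face `F` of `𝕊^k_+`. -/
def FacialConstantRank {k : ℕ} (g : Vec n → SymMat k) (xbar : Vec n) : Prop :=
  ∃ V ∈ 𝓝 xbar, ∀ F : Set (SymMat k), IsFace (psdCone k) F → ∀ x ∈ V,
    Module.finrank ℝ (Submodule.map (derivAdjoint g x) (Submodule.span ℝ F)ᗮ) =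
      Module.finrank ℝ (Submodule.map (derivAdjoint g xbar) (Submodule.span ℝ F)ᗮ)

/-- The linearized tangent cone `𝓛_Ω(xbar)`. -/
def linearizedCone (G : Vec n → SymMat m) (xbar : Vec n) : Set (Vec n) :=
  {d | fderiv ℝ G xbar d ∈ tangentCone (psdCone m) (G xbar)}

/-- The critical cone `C(xbar)`. -/
def criticalCone (f : Vec n → ℝ) (G : Vec n → SymMat m) (xbar : Vec n) : Set (Vec n) :=
  {d | d ∈ tangentCone (feasibleSet G) xbar ∧ inner ℝ (gradient f xbar) d = 0}

/-- The set `Λ(xbar)` of Lagrange multipliers. -/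
def multipliers (f : Vec n → ℝ) (G : Vec n → SymMat m) (xbar : Vec n) : Set (SymMat m) :=
  {lam | lam ∈ polarSet (psdCone m) ∧ gradient f xbar + derivAdjoint G xbar lam = 0 ∧
    inner ℝ (G xbar) lam = 0}

/-- The sigma-term `σ(d, xbar, lam)`: the support function at `lam` of the second-order tangent
set to `𝕊^m_+` at `G(xbar)` in the direction `D G(xbar) d`, as an extended real number. -/
noncomputable def sigmaTerm (G : Vec n → SymMat m) (d xbar : Vec n) (lam : SymMat m) : EReal :=
  ⨆ w ∈ secondTangentSet (psdCone m) (G xbar) (fderiv ℝ G xbar d),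
    ((inner ℝ w lam : ℝ) : EReal)

/-- The partial derivative `D_{x_i} G(x)`. -/
noncomputable def partialDeriv (G : Vec n → SymMat m) (x : Vec n) (i : Fin n) : SymMat m :=
  fderiv ℝ G x (EuclideanSpace.single i 1)

/-- The matrix `[2 ⟪D_{x_i} G(xbar) G(xbar)^† D_{x_j} G(xbar), lam⟫]_{i,j}`. -/
noncomputable def shapiroMatrix (G : Vec n → SymMat m) (xbar : Vec n) (lam : SymMat m) :
    Matrix (Fin n) (Fin n) ℝ :=
  Matrix.of fun i j =>
    2 * inner ℝ ((partialDeriv G xbar i).1 * pinv (G xbar) * (partialDeriv G xbar j).1) lam.1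

end Problem

end NSDP

/-! Write `𝒢 = EᵀGE`. It vanishes at `xbar`, and there its derivative is the compression of `DG` to
the kernel of `G xbar`. For a linearized direction `d` the matrix `Y = D𝒢(xbar)d` is positive
semidefinite; let `Q` be the projection onto `ker Y` and `F` the face of all `Z ⪰ 0` with `ZQ = 0`.
Constant rank for `F` gives a `C²` curve `x` with velocity `d` along which `𝒢` stays in `span F`
(`exists_curve_of_constant_rank`). Since `Y` is positive definite off `ker Y`, `𝒢(x t) = tY + o(t)`
is positive semidefinite for small `t > 0`. So is `A t = G(x t)`, because its other eigenvalues stay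
positive. Hence `d` is tangent to the feasible set (`exists_feasible_curve`).

The columns of `V t = 𝓔(A t)Q` lie in the kernel of `A t`. Differentiating `AV = 0` twice gives
`VᵀA''V = 2VᵀA'A†A'V` at `0` (`transpose_mul_second_deriv`). For critical `d`, complementarity
confines a multiplier to the range of `V 0` (`eq_frame_conj`), so `⟨A'', lam⟩` equals the quadratic
form. As `A''` is a second-order tangent, the supremum is at least this value; a congruence argument
bounds it above (`trace_le_of_mem_secondTangentSet`).

Finally `f(x t)` has zero derivative and a one-sided minimum at `0`, so its second derivative is
nonnegative. The multiplier equation turns the term in `x''` into the sigma-term. -/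

namespace NSDP

/-! ### Positive semidefinite matrices and the polar cone. -/

section PosSemidef

variable {m k : ℕ}

theorem posSemidef_transpose_mul_mul {A : Matrix (Fin m) (Fin m) ℝ} (hA : A.PosSemidef)
    (B : Matrix (Fin m) (Fin k) ℝ) : (Bᵀ * A * B).PosSemidef := by
  simpa [Matrix.conjTranspose_eq_transpose_of_trivial] using hA.conjTranspose_mul_mul_same B

theorem posSemidef_mul_mul_transpose {A : Matrix (Fin m) (Fin m) ℝ} (hA : A.PosSemidef)
    (B : Matrix (Fin k) (Fin m) ℝ) : (B * A * Bᵀ).PosSemidef := by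
  simpa [Matrix.conjTranspose_eq_transpose_of_trivial] using hA.mul_mul_conjTranspose_same B

theorem isHermitian_of_transpose_eq {A : Matrix (Fin m) (Fin m) ℝ} (hA : Aᵀ = A) :
    A.IsHermitian := by
  rw [Matrix.IsHermitian, Matrix.conjTranspose_eq_transpose_of_trivial, hA]

theorem PosSemidef.transpose_eq {A : Matrix (Fin m) (Fin m) ℝ} (hA : A.PosSemidef) : Aᵀ = A := by
  have h := hA.isHermitian.eq
  rwa [Matrix.conjTranspose_eq_transpose_of_trivial] at h

/-- A symmetric matrix is positive semidefinite if its compressions to an invariant subspace and to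
the orthogonal complement of this subspace are. -/
theorem posSemidef_of_invariant {A : Matrix (Fin m) (Fin m) ℝ} {E : Matrix (Fin m) (Fin k) ℝ}
    (hA : Aᵀ = A) (hE : Eᵀ * E = 1) (hAE : A * E = E * (Eᵀ * A * E))
    (hC : (Eᵀ * A * E).PosSemidef) (hB : (A + E * Eᵀ).PosSemidef) : A.PosSemidef := by
  have h1 := posSemidef_mul_mul_transpose hC E
  have h2 := posSemidef_transpose_mul_mul hB (1 - E * Eᵀ)
  have hEA : Eᵀ * A = (Eᵀ * A * E) * Eᵀ := by
    have h := congrArg Matrix.transpose hAE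
    simpa [Matrix.transpose_mul, hA, Matrix.mul_assoc] using h
  have hz : (E * Eᵀ) * (1 - E * Eᵀ) = 0 := by
    rw [mul_sub, mul_one, Matrix.mul_assoc E, ← Matrix.mul_assoc Eᵀ, hE, Matrix.one_mul, sub_self]
  -- Invariance removes the off-diagonal blocks, and the added `E * Eᵀ` disappears on the orthogonal
  -- complement.
  have h3 : A = E * (Eᵀ * A * E) * Eᵀ + (1 - E * Eᵀ)ᵀ * (A + E * Eᵀ) * (1 - E * Eᵀ) := by
    have ht : (1 - E * Eᵀ)ᵀ = 1 - E * Eᵀ := by simp [Matrix.transpose_mul]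
    have h4 : E * (Eᵀ * A * E) * Eᵀ = E * Eᵀ * A := by
      rw [Matrix.mul_assoc E, ← hEA, Matrix.mul_assoc]
    have h5 : A * (E * Eᵀ) = E * Eᵀ * A := by
      rw [← Matrix.mul_assoc, hAE, h4]
    have h6 : (E * Eᵀ) * (A * (1 - E * Eᵀ)) = 0 := by
      rw [← Matrix.mul_assoc, ← h5, Matrix.mul_assoc, hz, Matrix.mul_zero]
    rw [ht, h4, Matrix.mul_assoc (1 - E * Eᵀ), add_mul, hz, add_zero, sub_mul, h6, Matrix.one_mul, sub_zero, mul_sub,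
      mul_one, h5]
    abel
  rw [h3]
  exact h1.add h2

/-- Compressing `Y + Q` by `1 - Q` returns `Y`. This lets a singular `Y` be replaced by `Y + Q`, to
which openness of positive definiteness applies. -/
theorem posSemidef_of_mul_eq_zero {Y Q : Matrix (Fin m) (Fin m) ℝ} (hY : Yᵀ = Y) (hQ : Qᵀ = Q)
    (hQQ : Q * Q = Q) (hYQ : Y * Q = 0) (h : (Y + Q).PosSemidef) : Y.PosSemidef := by
  have hQY : Q * Y = 0 := by
    have h := congrArg Matrix.transpose hYQ
    simpa [Matrix.transpose_mul, hY, hQ] using h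
  have h2 := posSemidef_transpose_mul_mul h (1 - Q)
  have h3 : (1 - Q)ᵀ * (Y + Q) * (1 - Q) = Y := by
    simp [sub_mul, mul_sub, mul_add, hQ, hQY, hYQ, hQQ]
  rwa [h3] at h2

theorem mulVec_eq_zero_of_dotProduct {A : Matrix (Fin m) (Fin m) ℝ} (hA : A.PosSemidef)
    {x : Fin m → ℝ} (hx : x ⬝ᵥ A *ᵥ x = 0) : A *ᵥ x = 0 :=
  (hA.dotProduct_mulVec_zero_iff x).1 (by simpa using hx)

theorem dotProduct_mulVec_nonneg {A : Matrix (Fin m) (Fin m) ℝ} (hA : A.PosSemidef)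
    (x : Fin m → ℝ) : 0 ≤ x ⬝ᵥ A *ᵥ x := by
  simpa using hA.dotProduct_mulVec_nonneg x

theorem posDef_add {A P : Matrix (Fin m) (Fin m) ℝ} (hA : A.PosSemidef) (hP : P.PosSemidef)
    (h : ∀ z, A *ᵥ z = 0 → P *ᵥ z = 0 → z = 0) : (A + P).PosDef := by
  refine Matrix.PosDef.of_dotProduct_mulVec_pos (hA.add hP).isHermitian fun {x} hx => ?_
  rw [star_trivial, Matrix.add_mulVec, dotProduct_add]
  have h1 := dotProduct_mulVec_nonneg hA x
  have h2 := dotProduct_mulVec_nonneg hP x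
  refine lt_of_le_of_ne (by positivity) fun h0 => hx (h x ?_ ?_)
  · exact mulVec_eq_zero_of_dotProduct hA (by linarith)
  · exact mulVec_eq_zero_of_dotProduct hP (by linarith)

/-- Positivity of the quadratic form on the compact unit sphere is an open condition. The
neighbourhood lies in the space of all matrices, so symmetry is asked of each `M`. -/
theorem eventually_posSemidef {B : Matrix (Fin m) (Fin m) ℝ} (hB : B.PosDef) :
    ∀ᶠ M in 𝓝 B, Mᵀ = M → M.PosSemidef := by
  have hc : Continuous fun p : Matrix (Fin m) (Fin m) ℝ × (Fin m → ℝ) => p.2 ⬝ᵥ p.1 *ᵥ p.2 :=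
    Continuous.dotProduct continuous_snd (Continuous.matrix_mulVec continuous_fst continuous_snd)
  have h1 : ∀ᶠ M in 𝓝 B, ∀ z ∈ Metric.sphere (0 : Fin m → ℝ) 1, 0 < z ⬝ᵥ M *ᵥ z := by
    refine (isCompact_sphere (0 : Fin m → ℝ) 1).eventually_forall_of_forall_eventually
      fun z hz => ?_
    have hz0 : z ≠ 0 := by
      rintro rfl
      simp at hz
    have h := hB.dotProduct_mulVec_pos hz0
    rw [star_trivial] at h
    exact hc.continuousAt.eventually (lt_mem_nhds h)
  filter_upwards [h1] with M hM hMs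
  refine Matrix.PosSemidef.of_dotProduct_mulVec_nonneg (isHermitian_of_transpose_eq hMs) fun x => ?_
  rw [star_trivial]
  by_cases hx : x = 0
  · simp [hx]
  have hn : 0 < ‖x‖ := norm_pos_iff.2 hx
  have h2 := hM (‖x‖⁻¹ • x) (by simp [norm_smul, hn.ne'])
  rw [Matrix.mulVec_smul, dotProduct_smul, smul_dotProduct, smul_smul, smul_eq_mul] at h2
  exact (pos_of_mul_pos_right h2 (by positivity)).le

open scoped MatrixOrder in
theorem exists_eq_transpose_mul_self {A : Matrix (Fin m) (Fin m) ℝ} (hA : A.PosSemidef) :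
    ∃ B : Matrix (Fin m) (Fin m) ℝ, A = Bᵀ * B := by
  obtain ⟨B, hB⟩ := (CStarAlgebra.nonneg_iff_eq_star_mul_self (a := A)).1 hA.nonneg
  exact ⟨B, by simpa [Matrix.star_eq_conjTranspose] using hB⟩

theorem mul_eq_zero_of_transpose_mul_mul {A : Matrix (Fin m) (Fin m) ℝ} (hA : A.PosSemidef)
    {C : Matrix (Fin m) (Fin k) ℝ} (h : Cᵀ * A * C = 0) : A * C = 0 := by
  ext i j
  have h1 : A *ᵥ C.col j = 0 := by
    refine mulVec_eq_zero_of_dotProduct hA ?_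
    have h2 := congrFun (congrFun h j) j
    rw [Matrix.mul_assoc] at h2
    exact h2
  exact congrFun h1 i

/-- With `B = CᵀC`, the trace is that of the positive semidefinite `CACᵀ`, which therefore vanishes.
-/
theorem mul_eq_zero_of_trace_mul {A B : Matrix (Fin m) (Fin m) ℝ} (hA : A.PosSemidef)
    (hB : B.PosSemidef) (h : (A * B).trace = 0) : A * B = 0 := by
  obtain ⟨C, rfl⟩ := exists_eq_transpose_mul_self hB
  have h1 : (C * A * Cᵀ).trace = 0 := by
    rw [Matrix.trace_mul_comm, ← Matrix.mul_assoc, Matrix.trace_mul_comm]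
    exact h
  have h2 := (posSemidef_mul_mul_transpose hA C).trace_eq_zero_iff.1 h1
  have h3 : A * Cᵀ = 0 := mul_eq_zero_of_transpose_mul_mul hA (by simpa using h2)
  rw [← Matrix.mul_assoc, h3, Matrix.zero_mul]

theorem trace_mul_nonneg {A B : Matrix (Fin m) (Fin m) ℝ} (hA : A.PosSemidef)
    (hB : B.PosSemidef) : 0 ≤ (A * B).trace := by
  obtain ⟨C, rfl⟩ := exists_eq_transpose_mul_self hB
  have h := (posSemidef_mul_mul_transpose hA C).trace_nonneg
  rwa [Matrix.trace_mul_comm, ← Matrix.mul_assoc, Matrix.trace_mul_comm] at h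

theorem inner_eq_trace (A B : SymMat m) : inner ℝ A B = (A.1 * B.1).trace := by
  change (A.1ᵀ * B.1).trace = _
  have h : A.1ᵀ = A.1 := A.2
  rw [h]

theorem posSemidef_neg_of_mem_polarSet {z : SymMat m} (hz : z ∈ polarSet (psdCone m)) :
    (-z.1).PosSemidef := by
  refine Matrix.PosSemidef.of_dotProduct_mulVec_nonneg (symMat_isHermitian z).neg fun x => ?_
  -- Testing polarity on the rank-one matrices `x xᵀ` suffices.
  have hp : (vecMulVec x x).PosSemidef := by
    simpa using Matrix.posSemidef_vecMulVec_self_star x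
  have h := hz ⟨vecMulVec x x, PosSemidef.transpose_eq hp⟩ hp
  rw [inner_eq_trace, Matrix.trace_mul_comm, Matrix.vecMulVec_mul, Matrix.trace_vecMulVec] at h
  rw [star_trivial, Matrix.neg_mulVec, dotProduct_neg, Matrix.dotProduct_mulVec, dotProduct_comm]
  linarith

end PosSemidef

/-! ### The projection onto the kernel. -/

section KerProj

variable {m k : ℕ}

theorem pinv_transpose (A : SymMat m) : (pinv A)ᵀ = pinv A := by
  simp [pinv, Matrix.transpose_mul, Matrix.mul_assoc]

/-- The orthogonal projection onto the kernel of `A`. -/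
noncomputable def kerProj (A : SymMat m) : Matrix (Fin m) (Fin m) ℝ := 1 - pinv A * A.1

theorem kerProj_transpose (A : SymMat m) : (kerProj A)ᵀ = kerProj A := by
  have h : (pinv A * A.1)ᵀ = pinv A * A.1 := (pinv_penrose A).2.2.2
  rw [kerProj, Matrix.transpose_sub, h, Matrix.transpose_one]

theorem kerProj_mul_self (A : SymMat m) : kerProj A * kerProj A = kerProj A := by
  have h : pinv A * A.1 * (pinv A * A.1) = pinv A * A.1 := by
    rw [← Matrix.mul_assoc, (pinv_penrose A).2.1]
  simp [kerProj, mul_sub, sub_mul, h]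

theorem mul_kerProj (A : SymMat m) : A.1 * kerProj A = 0 := by
  rw [kerProj, mul_sub, mul_one, ← Matrix.mul_assoc, (pinv_penrose A).1, sub_self]

theorem posSemidef_kerProj (A : SymMat m) : (kerProj A).PosSemidef := by
  have h := posSemidef_transpose_mul_mul (Matrix.PosSemidef.one (n := Fin m) (R := ℝ)) (kerProj A)
  rwa [mul_one, kerProj_transpose, kerProj_mul_self] at h

theorem kerProj_mul_of_mul_eq_zero (A : SymMat m) {B : Matrix (Fin m) (Fin k) ℝ}
    (h : A.1 * B = 0) : kerProj A * B = B := by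
  rw [kerProj, Matrix.sub_mul, Matrix.one_mul, Matrix.mul_assoc, h, Matrix.mul_zero, sub_zero]

theorem posDef_add_kerProj {A : SymMat m} (hA : A.1.PosSemidef) : (A.1 + kerProj A).PosDef := by
  refine posDef_add hA (posSemidef_kerProj A) fun z h1 h2 => ?_
  rwa [kerProj, Matrix.sub_mulVec, Matrix.one_mulVec, ← Matrix.mulVec_mulVec, h1,
    Matrix.mulVec_zero, sub_zero] at h2

end KerProj

/-! ### Orthonormal frames of kernels and low eigenspaces. -/

section Frame

variable {m k : ℕ}

theorem mul_transpose_mulVec {E : Matrix (Fin m) (Fin k) ℝ} {S : Submodule ℝ (Fin m → ℝ)}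
    (hE : IsOrthonormalBasisMatrix E S) {z : Fin m → ℝ} (hz : z ∈ S) : E *ᵥ (Eᵀ *ᵥ z) = z := by
  rw [← hE.2, ← Matrix.range_mulVecLin] at hz
  obtain ⟨c, rfl⟩ := hz
  rw [Matrix.mulVecLin_apply, Matrix.mulVec_mulVec c, hE.1, Matrix.one_mulVec]

theorem col_mem {E : Matrix (Fin m) (Fin k) ℝ} {S : Submodule ℝ (Fin m → ℝ)}
    (hE : IsOrthonormalBasisMatrix E S) (j : Fin k) : E.col j ∈ S := by
  rw [← hE.2]
  exact Submodule.subset_span ⟨j, rfl⟩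

theorem mulVec_mem_lowEigenspace (A : SymMat m) (r : ℕ) {z : Fin m → ℝ}
    (hz : z ∈ lowEigenspace A r) : A.1 *ᵥ z ∈ lowEigenspace A r := by
  rw [← Matrix.toLin'_apply]
  rw [lowEigenspace] at hz
  induction hz using Submodule.iSup_induction' with
  | mem i x hx =>
    rw [Module.End.mem_eigenspace_iff.1 hx]
    exact Submodule.smul_mem _ _ (Submodule.mem_iSup_of_mem i hx)
  | zero => simp
  | add x y _ _ hx hy => rw [map_add]; exact Submodule.add_mem _ hx hy

theorem mul_frame_eq {A : SymMat m} {r : ℕ} {E : Matrix (Fin m) (Fin k) ℝ}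
    (hE : IsOrthonormalBasisMatrix E (lowEigenspace A r)) :
    A.1 * E = E * (Eᵀ * A.1 * E) := by
  ext i j
  have h := congrFun (mul_transpose_mulVec hE (mulVec_mem_lowEigenspace A r (col_mem hE j))) i
  rw [Matrix.mulVec_mulVec, Matrix.mulVec_mulVec] at h
  rw [Matrix.mul_assoc Eᵀ, ← Matrix.mul_assoc, ← Matrix.mul_assoc]
  exact h.symm

theorem mul_kerFrame_eq_zero {A : SymMat m} {E : Matrix (Fin m) (Fin k) ℝ}
    (hE : IsOrthonormalBasisMatrix E (LinearMap.ker (Matrix.toLin' A.1))) : A.1 * E = 0 := by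
  ext i j
  exact congrFun (LinearMap.mem_ker.1 (col_mem hE j)) i

theorem kerFrame_mul_transpose_mul {A : SymMat m} {E : Matrix (Fin m) (Fin k) ℝ}
    (hE : IsOrthonormalBasisMatrix E (LinearMap.ker (Matrix.toLin' A.1)))
    {l : ℕ} {B : Matrix (Fin m) (Fin l) ℝ} (hB : A.1 * B = 0) : E * Eᵀ * B = B := by
  ext i j
  have h1 : B.col j ∈ LinearMap.ker (Matrix.toLin' A.1) := by
    rw [LinearMap.mem_ker, Matrix.toLin'_apply]
    ext i
    exact congrFun (congrFun hB i) j
  have h := congrFun (mul_transpose_mulVec hE h1) i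
  rw [Matrix.mulVec_mulVec] at h
  exact h

theorem posDef_add_kerFrame {A : SymMat m} {E : Matrix (Fin m) (Fin k) ℝ}
    (hE : IsOrthonormalBasisMatrix E (LinearMap.ker (Matrix.toLin' A.1))) (hA : A.1.PosSemidef) :
    (A.1 + E * Eᵀ).PosDef := by
  have hP : (E * Eᵀ).PosSemidef := by
    simpa using posSemidef_mul_mul_transpose (Matrix.PosSemidef.one (n := Fin k) (R := ℝ)) E
  refine posDef_add hA hP fun z h1 h2 => ?_
  have h3 : z ∈ LinearMap.ker (Matrix.toLin' A.1) := h1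
  rw [← mul_transpose_mulVec hE h3, Matrix.mulVec_mulVec, h2]

end Frame

/-! ### Taylor expansion and a constant rank theorem. -/

section Curves

variable {X W : Type*} [NormedAddCommGroup X] [NormedAddCommGroup W]

theorem eventually_differentiableAt [NormedSpace ℝ X] [NormedSpace ℝ W] {g : X → W} {a : X}
    (hg : ContDiffAt ℝ 2 g a) : ∀ᶠ x in 𝓝 a, DifferentiableAt ℝ g x :=
  (hg.eventually (by simp)).mono fun _ hx => hx.differentiableAt (by simp)

theorem differentiableAt_deriv [NormedSpace ℝ W] {g : ℝ → W} {a : ℝ} (hg : ContDiffAt ℝ 2 g a) :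
    DifferentiableAt ℝ (deriv g) a :=
  (hg.derivWithin (m := 1) (by norm_num)).differentiableAt (by simp)

/-- Taylor's formula of second order. -/
theorem taylor_two_isLittleO [NormedSpace ℝ W] {g : ℝ → W} (hg : ContDiffAt ℝ 2 g 0) :
    (fun t => g t - (g 0 + t • deriv g 0 + (t ^ 2 / 2) • deriv (deriv g) 0)) =o[𝓝 0]
      fun t : ℝ => t ^ 2 := by
  obtain ⟨ε, hε, hball⟩ := Metric.eventually_nhds_iff_ball.1 (eventually_differentiableAt hg)
  set R : ℝ → W := fun t => g t - (g 0 + t • deriv g 0 + (t ^ 2 / 2) • deriv (deriv g) 0)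
  have hR : ∀ t ∈ Metric.ball (0 : ℝ) ε,
      HasDerivWithinAt R (deriv g t - deriv g 0 - t • deriv (deriv g) 0) (Metric.ball 0 ε) t := by
    intro t ht
    have h1 : HasDerivAt (fun t : ℝ => g 0 + t • deriv g 0 + (t ^ 2 / 2) • deriv (deriv g) 0)
        (deriv g 0 + t • deriv (deriv g) 0) t := by
      have h2 := ((hasDerivAt_id t).smul_const (deriv g 0)).const_add (g 0)
      have h3 := (((hasDerivAt_id t).pow 2).div_const 2).smul_const (deriv (deriv g) 0)
      refine (h2.add h3).congr_deriv ?_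
      simp
    refine ((hball t ht).hasDerivAt.sub h1).hasDerivWithinAt.congr_deriv ?_
    abel
  have hz : (fun t => deriv g t - deriv g 0 - t • deriv (deriv g) 0)
      =o[𝓝[Metric.ball 0 ε] 0] fun t : ℝ => (t - 0) ^ 1 := by
    have h := (differentiableAt_deriv hg).hasDerivAt.isLittleO
    simpa using h.mono nhdsWithin_le_nhds
  have h := (convex_ball (0 : ℝ) ε).isLittleO_pow_succ_real (Metric.mem_ball_self hε) hR hz
  rw [Metric.isOpen_ball.nhdsWithin_eq (Metric.mem_ball_self hε)] at h
  simpa [R] using h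

theorem deriv_comp_curve [NormedSpace ℝ X] [NormedSpace ℝ W] {g : X → W} (hg : ContDiff ℝ 2 g)
    {x : ℝ → X} {t : ℝ} (hx : DifferentiableAt ℝ x t) :
    HasDerivAt (fun s => g (x s)) (fderiv ℝ g (x t) (deriv x t)) t :=
  ((hg.differentiable (by simp)) (x t)).hasFDerivAt.comp_hasDerivAt t hx.hasDerivAt

theorem deriv_deriv_comp_curve [NormedSpace ℝ X] [NormedSpace ℝ W] {g : X → W}
    (hg : ContDiff ℝ 2 g) {x : ℝ → X} {t : ℝ} (hx : ContDiffAt ℝ 2 x t) :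
    deriv (deriv fun s => g (x s)) t =
      fderiv ℝ (fderiv ℝ g) (x t) (deriv x t) (deriv x t) +
        fderiv ℝ g (x t) (deriv (deriv x) t) := by
  have h1 : (deriv fun s => g (x s)) =ᶠ[𝓝 t] fun s => fderiv ℝ g (x s) (deriv x s) := by
    filter_upwards [eventually_differentiableAt hx] with s hs
    exact (deriv_comp_curve hg hs).deriv
  rw [h1.deriv_eq]
  have h2 : HasFDerivAt (fderiv ℝ g) (fderiv ℝ (fderiv ℝ g) (x t)) (x t) :=
    ((hg.fderiv_right (m := 1) (by norm_num)).differentiable (by simp) (x t)).hasFDerivAt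
  have h3 := h2.comp_hasDerivAt t (hx.differentiableAt (by simp)).hasDerivAt
  exact (h3.clm_apply (differentiableAt_deriv hx).hasDerivAt).deriv

variable [InnerProductSpace ℝ X] [InnerProductSpace ℝ W] [FiniteDimensional ℝ X]
  [FiniteDimensional ℝ W]

/-- If the derivative of `h` has constant rank near a zero `a` of `h`, every vector in its kernel
at `a` is the velocity of a smooth curve of zeros of `h`. -/
theorem exists_curve_of_constant_rank {h : X → W} {a d : X} (hh : ContDiffAt ℝ 2 h a)
    (h0 : h a = 0)
    (hrank : ∀ᶠ x in 𝓝 a, Module.finrank ℝ (LinearMap.ker (fderiv ℝ h x : X →ₗ[ℝ] W)) =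
      Module.finrank ℝ (LinearMap.ker (fderiv ℝ h a : X →ₗ[ℝ] W)))
    (hd : fderiv ℝ h a d = 0) :
    ∃ x : ℝ → X, ContDiffAt ℝ 2 x 0 ∧ x 0 = a ∧ deriv x 0 = d ∧ ∀ᶠ t in 𝓝 0, h (x t) = 0 := by
  set L := fderiv ℝ h a with hL
  set K := LinearMap.ker (L : X →ₗ[ℝ] W) with hK
  set La := ContinuousLinearMap.adjoint L with hLa
  have hπLa : ∀ w, K.starProjection (La w) = 0 := by
    intro w
    rw [Submodule.starProjection_apply_eq_zero_iff, Submodule.mem_orthogonal]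
    intro u hu
    rw [hLa, ContinuousLinearMap.adjoint_inner_right]
    have : L u = 0 := hu
    rw [this, inner_zero_left]
  have hπd : K.starProjection d = d := Submodule.starProjection_eq_self_iff.2 hd
  -- The range of `La` is orthogonal to `K = ker L`, so `φ` records `h` and the `K`-coordinate
  -- independently; its derivative at `a` is invertible and `φ` has a local inverse `ψ`.
  set φ : X → X := fun x => La (h x) + K.starProjection (x - a) with hφ
  have hφD : ∀ x, DifferentiableAt ℝ h x →
      HasFDerivAt φ (La.comp (fderiv ℝ h x) + K.starProjection) x := fun x hx =>
    (La.hasFDerivAt.comp x hx.hasFDerivAt).add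
      (K.starProjection.hasFDerivAt.comp x ((hasFDerivAt_id x).sub_const a))
  have hinj : Function.Injective (La.comp L + K.starProjection) := by
    rw [injective_iff_map_eq_zero]
    intro v hv
    have hv' : La (L v) + K.starProjection v = 0 := hv
    have h1 : K.starProjection v = 0 := by
      have h2 := congrArg K.starProjection hv'
      rw [map_add, hπLa, zero_add, map_zero] at h2
      rw [← h2]
      exact (Submodule.starProjection_eq_self_iff.2 (Submodule.starProjection_apply_mem K v)).symm
    rw [h1, add_zero] at hv'
    have h3 : L v = 0 := by
      have h4 : inner ℝ (La (L v)) v = 0 := by rw [hv', inner_zero_left]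
      rw [hLa, ContinuousLinearMap.adjoint_inner_left] at h4
      exact inner_self_eq_zero.1 h4
    rw [← h1]
    exact (Submodule.starProjection_eq_self_iff.2 h3).symm
  set D : X ≃L[ℝ] X := (LinearEquiv.ofInjectiveEndo
    ((La.comp L + K.starProjection : X →L[ℝ] X) : X →ₗ[ℝ] X) hinj).toContinuousLinearEquiv with hDdef
  have hD : (D : X →L[ℝ] X) = La.comp L + K.starProjection := by
    ext v
    simp [D]
  have hφa : φ a = 0 := by simp [hφ, h0]
  have hφC : ContDiffAt ℝ 2 φ a :=
    (La.contDiff.contDiffAt.comp a hh).add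
      (K.starProjection.contDiff.contDiffAt.comp a (contDiffAt_id.sub contDiffAt_const))
  have hφ' : HasFDerivAt φ (D : X →L[ℝ] X) a := by
    rw [hD]
    exact hφD a (hh.differentiableAt (by simp))
  have hS := hφC.hasStrictFDerivAt' hφ' (by simp)
  set ψ := hφC.localInverse hφ' (by simp) with hψ
  have hψC : ContDiffAt ℝ 2 ψ 0 := hφa ▸ hφC.to_localInverse hφ' (by simp)
  have hψ0 : ψ 0 = a := hφa ▸ hφC.localInverse_apply_image hφ' (by simp)
  have hψR : ∀ᶠ y in 𝓝 (0 : X), φ (ψ y) = y := hφa ▸ hS.eventually_right_inverse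
  have hψD : HasFDerivAt ψ (D.symm : X →L[ℝ] X) 0 := by
    have := hS.to_localInverse.hasFDerivAt
    rwa [hφa] at this
  have hline : Tendsto (fun t : ℝ => t • d) (𝓝 0) (𝓝 0) := by
    have : Continuous fun t : ℝ => t • d := by fun_prop
    simpa using this.tendsto 0
  have hxC : ContDiffAt ℝ 2 (fun t : ℝ => ψ (t • d)) 0 := by
    refine ContDiffAt.comp (0 : ℝ) (g := ψ) (by simpa using hψC) ?_
    exact contDiffAt_id.smul contDiffAt_const
  have hxD : deriv (fun t : ℝ => ψ (t • d)) 0 = d := by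
    have h1 : HasDerivAt (fun t : ℝ => t • d) d 0 := by
      simpa using (hasDerivAt_id (0 : ℝ)).smul_const d
    have h2 : HasDerivAt (fun t : ℝ => ψ (t • d)) (D.symm d) 0 := by
      have h2 : HasFDerivAt ψ (D.symm : X →L[ℝ] X) ((0 : ℝ) • d) := by simpa using hψD
      exact h2.comp_hasDerivAt (0 : ℝ) h1
    rw [h2.deriv, ContinuousLinearEquiv.symm_apply_eq]
    have h3 : D d = La (L d) + K.starProjection d := DFunLike.congr_fun hD d
    rw [h3, hd, hπd, map_zero, zero_add]
  refine ⟨fun t => ψ (t • d), hxC, by simp [hψ0], hxD, ?_⟩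
  have hxa : Tendsto (fun t : ℝ => ψ (t • d)) (𝓝 0) (𝓝 a) := by
    simpa [hψ0] using hxC.continuousAt.tendsto
  -- The curve solves `φ (x t) = t • d` with `d ∈ K`; the component orthogonal to `K` is `La (h (x
  -- t))`.
  have hLah : ∀ᶠ t : ℝ in 𝓝 0, La (h (ψ (t • d))) = 0 := by
    filter_upwards [hline.eventually hψR] with t ht
    have h1 : La (h (ψ (t • d))) + K.starProjection (ψ (t • d) - a) = t • d := ht
    have h2 := congrArg K.starProjection h1
    rw [map_add, hπLa, zero_add, map_smul, hπd,
      Submodule.starProjection_eq_self_iff.2 (Submodule.starProjection_apply_mem K _)] at h2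
    rw [h2] at h1
    simpa using h1
  -- Here constant rank enters. Projection to `K` is injective on `ker (La ∘ Dh x)`, so this kernel
  -- has dimension at most `dim K = dim ker (Dh x)`. Containing `ker (Dh x)`, it equals it.
  have hker : ∀ᶠ x in 𝓝 a, ∀ v, La (fderiv ℝ h x v) = 0 → fderiv ℝ h x v = 0 := by
    have hcont : ContinuousAt (fun x => La.comp (fderiv ℝ h x) + K.starProjection) a := by
      have h1 : ContinuousAt (fderiv ℝ h) a :=
        (hh.fderiv_right (m := 1) (by norm_num)).continuousAt
      exact (ContinuousAt.clm_comp continuousAt_const h1).add continuousAt_const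
    have hunit : ∀ᶠ x in 𝓝 a, La.comp (fderiv ℝ h x) + K.starProjection ∈
        Set.range ((↑) : (X ≃L[ℝ] X) → X →L[ℝ] X) := by
      refine hcont.eventually ?_
      change Set.range ((↑) : (X ≃L[ℝ] X) → X →L[ℝ] X) ∈ 𝓝 (La.comp L + K.starProjection)
      rw [← hD]
      exact ContinuousLinearEquiv.nhds D
    filter_upwards [hunit, hrank] with x hx hxr
    obtain ⟨e, he⟩ := hx
    set N := LinearMap.ker ((La.comp (fderiv ℝ h x) : X →L[ℝ] X) : X →ₗ[ℝ] X) with hN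
    have hle : LinearMap.ker (fderiv ℝ h x : X →ₗ[ℝ] W) ≤ N := by
      intro v hv
      have hv' : fderiv ℝ h x v = 0 := hv
      change La (fderiv ℝ h x v) = 0
      rw [hv', map_zero]
    have hfr : Module.finrank ℝ N ≤ Module.finrank ℝ K := by
      refine LinearMap.finrank_le_finrank_of_injective
        (f := (K.orthogonalProjectionOnto : X →ₗ[ℝ] K).comp N.subtype) ?_
      rw [injective_iff_map_eq_zero]
      rintro ⟨v, hv⟩ hv0
      have hv' : La (fderiv ℝ h x v) = 0 := hv
      have hv1 : K.starProjection v = 0 := congrArg Subtype.val hv0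
      have h3 : e v = La (fderiv ℝ h x v) + K.starProjection v := DFunLike.congr_fun he v
      rw [hv', hv1, add_zero] at h3
      exact Subtype.ext (by simpa using h3)
    have heq := Submodule.eq_of_le_of_finrank_le hle (hxr ▸ hfr)
    intro v hv
    have : v ∈ LinearMap.ker (fderiv ℝ h x : X →ₗ[ℝ] W) := by
      rw [heq]
      exact hv
    exact this
  -- `La` kills the derivative of `h` along the curve, so by `hker` that derivative is zero and `h`
  -- stays equal to `h a = 0`.
  have hderiv : ∀ᶠ t : ℝ in 𝓝 0, HasDerivAt (fun s : ℝ => h (ψ (s • d))) 0 t := by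
    filter_upwards [hLah.eventually_nhds, hxa.eventually hker,
      hxa.eventually (eventually_differentiableAt hh), eventually_differentiableAt hxC]
      with t h1 h2 h3 h4
    have h5 := h3.hasFDerivAt.comp_hasDerivAt t h4.hasDerivAt
    have h6 := La.hasFDerivAt.comp_hasDerivAt t h5
    have h7 := h6.unique ((hasDerivAt_const t (0 : X)).congr_of_eventuallyEq h1)
    rw [h2 _ h7] at h5
    exact h5
  obtain ⟨ε, hε, hball⟩ := Metric.eventually_nhds_iff_ball.1 hderiv
  filter_upwards [Metric.ball_mem_nhds (0 : ℝ) hε] with t ht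
  have h1 := (convex_ball (0 : ℝ) ε).norm_image_sub_le_of_norm_hasDerivWithin_le (C := 0)
    (fun s hs => (hball s hs).hasDerivWithinAt) (by simp) (Metric.mem_ball_self hε) ht
  simpa [hψ0, h0] using h1

end Curves

/-! ### Differentiating matrix-valued maps. -/

section MatrixCalculus

variable {a b c m k : ℕ} {X : Type*} [NormedAddCommGroup X] [NormedSpace ℝ X]

theorem isBoundedBilinearMap_matrix_mul :
    IsBoundedBilinearMap ℝ
      fun p : Matrix (Fin a) (Fin b) ℝ × Matrix (Fin b) (Fin c) ℝ => p.1 * p.2 where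
  add_left := Matrix.add_mul
  smul_left := Matrix.smul_mul
  add_right := Matrix.mul_add
  smul_right r M N := Matrix.mul_smul M r N
  bound := ⟨1, one_pos, fun M N => by simpa using Matrix.frobenius_norm_mul M N⟩

theorem contDiffAt_matrix_mul {M : X → Matrix (Fin a) (Fin b) ℝ} {N : X → Matrix (Fin b) (Fin c) ℝ}
    {x : X} (hM : ContDiffAt ℝ 2 M x) (hN : ContDiffAt ℝ 2 N x) :
    ContDiffAt ℝ 2 (fun y => M y * N y) x :=
  isBoundedBilinearMap_matrix_mul.contDiff.contDiffAt.comp x (hM.prodMk hN)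

theorem hasDerivAt_matrix_mul {M : ℝ → Matrix (Fin a) (Fin b) ℝ}
    {N : ℝ → Matrix (Fin b) (Fin c) ℝ} {M' : Matrix (Fin a) (Fin b) ℝ}
    {N' : Matrix (Fin b) (Fin c) ℝ} {t : ℝ} (hM : HasDerivAt M M' t) (hN : HasDerivAt N N' t) :
    HasDerivAt (fun s => M s * N s) (M t * N' + M' * N t) t :=
  HasFDerivAt.comp_hasDerivAt (f := fun s => (M s, N s)) t
    (isBoundedBilinearMap_matrix_mul.hasFDerivAt (M t, N t)) (hM.prodMk hN)

/-- Transposition as a continuous linear map. -/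
noncomputable def transposeL (a b : ℕ) :
    Matrix (Fin a) (Fin b) ℝ →L[ℝ] Matrix (Fin b) (Fin a) ℝ :=
  LinearMap.toContinuousLinearMap (Matrix.transposeLinearEquiv (Fin a) (Fin b) ℝ ℝ).toLinearMap

theorem contDiffAt_coe {A : X → SymMat m} {x : X} (hA : ContDiffAt ℝ 2 A x) :
    ContDiffAt ℝ 2 (fun y => (A y).1) x :=
  (SymMat m).subtypeL.contDiff.contDiffAt.comp x hA

theorem hasDerivAt_coe {A : ℝ → SymMat m} {A' : SymMat m} {t : ℝ} (hA : HasDerivAt A A' t) :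
    HasDerivAt (fun s => (A s).1) A'.1 t :=
  (SymMat m).subtypeL.hasFDerivAt.comp_hasDerivAt t hA

/-- Orthogonal projection onto the symmetric matrices is a smooth left inverse of the inclusion. -/
theorem contDiffAt_of_coe {A : X → SymMat m} {x : X}
    (hA : ContDiffAt ℝ 2 (fun y => (A y).1) x) : ContDiffAt ℝ 2 A x := by
  have h := (SymMat m).orthogonalProjectionOnto.contDiff.contDiffAt.comp x hA
  refine h.congr_of_eventuallyEq (Eventually.of_forall fun y => ?_)
  exact (Submodule.orthogonalProjectionOnto_mem_subspace_eq_self (A y)).symm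

end MatrixCalculus

/-! ### The reduced constraint. -/

section Reduced

variable {n m k : ℕ} {G : Vec n → SymMat m} {𝓔 : SymMat m → Matrix (Fin m) (Fin k) ℝ}
  {xbar : Vec n}

theorem contDiffAt_reducedConstraint (hG : ContDiff ℝ 2 G) (hE : AnalyticAt ℝ 𝓔 (G xbar)) :
    ContDiffAt ℝ 2 (reducedConstraint 𝓔 G) xbar := by
  have h1 : ContDiffAt ℝ 2 (fun x => 𝓔 (G x)) xbar :=
    hE.contDiffAt.comp xbar hG.contDiffAt
  have h2 : ContDiffAt ℝ 2 (fun x => (𝓔 (G x))ᵀ) xbar :=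
    (transposeL m k).contDiff.contDiffAt.comp xbar h1
  exact contDiffAt_of_coe
    (contDiffAt_matrix_mul (contDiffAt_matrix_mul h2 (contDiffAt_coe hG.contDiffAt)) h1)

/-- In the product rule both terms with the derivative of `𝓔` contain `G xbar` times the frame or
its transpose, hence vanish. -/
theorem fderiv_reducedConstraint (hG : ContDiff ℝ 2 G) (hE : AnalyticAt ℝ 𝓔 (G xbar))
    (h0 : (G xbar).1 * 𝓔 (G xbar) = 0) (d : Vec n) :
    fderiv ℝ (reducedConstraint 𝓔 G) xbar d = compress (𝓔 (G xbar)) (fderiv ℝ G xbar d) := by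
  have hline : HasDerivAt (fun t : ℝ => xbar + t • d) d 0 := by
    simpa using ((hasDerivAt_id (0 : ℝ)).smul_const d).const_add xbar
  have hz : xbar + (0 : ℝ) • d = xbar := by simp
  have hA : HasDerivAt (fun t : ℝ => G (xbar + t • d)) (fderiv ℝ G xbar d) 0 := by
    have h : HasFDerivAt G (fderiv ℝ G xbar) (xbar + (0 : ℝ) • d) := by
      rw [hz]; exact (hG.differentiable (by simp) xbar).hasFDerivAt
    exact h.comp_hasDerivAt (0 : ℝ) hline
  have hR : HasDerivAt (fun t : ℝ => reducedConstraint 𝓔 G (xbar + t • d))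
      (fderiv ℝ (reducedConstraint 𝓔 G) xbar d) 0 := by
    have h : HasFDerivAt (reducedConstraint 𝓔 G) (fderiv ℝ (reducedConstraint 𝓔 G) xbar)
        (xbar + (0 : ℝ) • d) := by
      rw [hz]
      exact ((contDiffAt_reducedConstraint hG hE).differentiableAt (by simp)).hasFDerivAt
    exact h.comp_hasDerivAt (0 : ℝ) hline
  have hEd : HasDerivAt (fun t : ℝ => 𝓔 (G (xbar + t • d)))
      (fderiv ℝ 𝓔 (G xbar) (fderiv ℝ G xbar d)) 0 := by
    have h : HasFDerivAt 𝓔 (fderiv ℝ 𝓔 (G xbar)) (G (xbar + (0 : ℝ) • d)) := by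
      rw [hz]; exact hE.differentiableAt.hasFDerivAt
    exact h.comp_hasDerivAt (0 : ℝ) hA
  have hEt : HasDerivAt (fun t : ℝ => (𝓔 (G (xbar + t • d)))ᵀ)
      (fderiv ℝ 𝓔 (G xbar) (fderiv ℝ G xbar d))ᵀ 0 :=
    (transposeL m k).hasFDerivAt.comp_hasDerivAt (0 : ℝ) hEd
  have h1 := hasDerivAt_matrix_mul (hasDerivAt_matrix_mul hEt (hasDerivAt_coe hA)) hEd
  have h2 := (hasDerivAt_coe hR).unique h1
  have h0' : (𝓔 (G xbar))ᵀ * (G xbar).1 = 0 := by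
    have h := congrArg Matrix.transpose h0
    have hs : (G xbar).1ᵀ = (G xbar).1 := (G xbar).2
    rwa [Matrix.transpose_mul, hs, Matrix.transpose_zero] at h
  apply Subtype.ext
  rw [h2]
  simp only [hz]
  rw [h0', Matrix.zero_mul, zero_add, Matrix.add_mul, Matrix.mul_assoc _ (G xbar).1, h0,
    Matrix.mul_zero, add_zero]
  rfl

end Reduced

/-! ### Faces of the semidefinite cone. -/

section Faces

variable {k : ℕ}

/-- The symmetric matrices `Y` with `Y Q = 0`. -/
def annihilator (Q : Matrix (Fin k) (Fin k) ℝ) : Submodule ℝ (SymMat k) where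
  carrier := {Y | Y.1 * Q = 0}
  add_mem' {Y Z} hY hZ := by
    change (Y.1 + Z.1) * Q = 0
    rw [Matrix.add_mul, show Y.1 * Q = 0 from hY, show Z.1 * Q = 0 from hZ, add_zero]
  zero_mem' := Matrix.zero_mul Q
  smul_mem' c Y hY := by
    change (c • Y.1) * Q = 0
    rw [Matrix.smul_mul, show Y.1 * Q = 0 from hY, smul_zero]

theorem convex_psdCone : Convex ℝ (psdCone k) := fun _ hx _ hy _ _ ha hb _ =>
  Matrix.PosSemidef.add (Matrix.PosSemidef.smul hx ha) (Matrix.PosSemidef.smul hy hb)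

theorem isFace_annihilator (Q : Matrix (Fin k) (Fin k) ℝ) :
    IsFace (psdCone k) (psdCone k ∩ annihilator Q) := by
  refine ⟨⟨0, Matrix.PosSemidef.zero, (annihilator Q).zero_mem⟩,
    convex_psdCone.inter (annihilator Q).convex, Set.inter_subset_left, ?_⟩
  rintro x hx y hy z ⟨-, hz⟩ ⟨s, t, hs, ht, -, rfl⟩
  have hx1 := posSemidef_transpose_mul_mul hx Q
  have hy1 := posSemidef_transpose_mul_mul hy Q
  have hz' : (s • x.1 + t • y.1) * Q = 0 := hz
  have h : s • (Qᵀ * x.1 * Q) + t • (Qᵀ * y.1 * Q) = 0 := by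
    have h1 : Qᵀ * ((s • x.1 + t • y.1) * Q) = 0 := by rw [hz', Matrix.mul_zero]
    rw [← h1]
    simp [Matrix.add_mul, Matrix.mul_add, Matrix.mul_assoc]
  -- The functional `Y ↦ tr (QᵀYQ)` is nonnegative on the cone and vanishes there only where `YQ =
  -- 0`, so it exposes the face.
  have htr := congrArg Matrix.trace h
  rw [Matrix.trace_add, Matrix.trace_smul, Matrix.trace_smul, Matrix.trace_zero, smul_eq_mul,
    smul_eq_mul] at htr
  have h1 := hx1.trace_nonneg
  have h2 := mul_nonneg ht.le hy1.trace_nonneg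
  have h3 : (Qᵀ * x.1 * Q).trace = 0 := by
    have h4 : s * (Qᵀ * x.1 * Q).trace = 0 := by
      have := mul_nonneg hs.le h1
      linarith
    exact (mul_eq_zero.1 h4).resolve_left hs.ne'
  exact ⟨hx, mul_eq_zero_of_transpose_mul_mul hx (hx1.trace_eq_zero_iff.1 h3)⟩

end Faces

/-! ### From ranks of adjoints to curves in a subspace. -/

section Rank

variable {X W : Type*} [NormedAddCommGroup X] [NormedAddCommGroup W] [InnerProductSpace ℝ X]
  [InnerProductSpace ℝ W] [FiniteDimensional ℝ X] [FiniteDimensional ℝ W]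

/-- Translates the dimension of `Lᵀ[S]`, used in the facial constant rank property, into the kernel
dimension required by the constant rank theorem. -/
theorem ker_starProjection_comp (L : X →L[ℝ] W) (S : Submodule ℝ W) :
    LinearMap.ker ((S.starProjection.comp L : X →L[ℝ] W) : X →ₗ[ℝ] W) =
      (S.map (LinearMap.adjoint (L : X →ₗ[ℝ] W)))ᗮ := by
  ext v
  rw [LinearMap.mem_ker, Submodule.mem_orthogonal]
  change S.starProjection (L v) = 0 ↔ _
  rw [Submodule.starProjection_apply_eq_zero_iff, Submodule.mem_orthogonal]
  constructor
  · rintro h _ ⟨s, hs, rfl⟩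
    rw [LinearMap.adjoint_inner_left]
    exact h s hs
  · intro h s hs
    have := h _ ⟨s, hs, rfl⟩
    rwa [LinearMap.adjoint_inner_left] at this

theorem finrank_ker_starProjection_comp (L : X →L[ℝ] W) (S : Submodule ℝ W) :
    Module.finrank ℝ (S.map (LinearMap.adjoint (L : X →ₗ[ℝ] W))) +
      Module.finrank ℝ (LinearMap.ker ((S.starProjection.comp L : X →L[ℝ] W) : X →ₗ[ℝ] W)) =
        Module.finrank ℝ X := by
  rw [ker_starProjection_comp]
  exact Submodule.finrank_add_finrank_orthogonal _

/-- The constant rank theorem is applied to the `Tᗮ`-component of `g`, whose zeros are the points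
with `g x ∈ T`. -/
theorem exists_curve_in_subspace {g : X → W} {a d : X} (hg : ContDiffAt ℝ 2 g a) (h0 : g a = 0)
    (T : Submodule ℝ W)
    (hrank : ∀ᶠ x in 𝓝 a,
      Module.finrank ℝ (Tᗮ.map (LinearMap.adjoint (fderiv ℝ g x : X →ₗ[ℝ] W))) =
        Module.finrank ℝ (Tᗮ.map (LinearMap.adjoint (fderiv ℝ g a : X →ₗ[ℝ] W))))
    (hd : fderiv ℝ g a d ∈ T) :
    ∃ x : ℝ → X, ContDiffAt ℝ 2 x 0 ∧ x 0 = a ∧ deriv x 0 = d ∧ ∀ᶠ t in 𝓝 0, g (x t) ∈ T := by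
  have hfd : ∀ᶠ x in 𝓝 a,
      fderiv ℝ (fun x => Tᗮ.starProjection (g x)) x = Tᗮ.starProjection.comp (fderiv ℝ g x) := by
    filter_upwards [eventually_differentiableAt hg] with x hx
    exact (Tᗮ.starProjection.hasFDerivAt.comp x hx.hasFDerivAt).fderiv
  obtain ⟨x, hx, hx0, hxd, hxz⟩ := exists_curve_of_constant_rank
    (h := fun x => Tᗮ.starProjection (g x)) (a := a) (d := d)
    (Tᗮ.starProjection.contDiff.contDiffAt.comp a hg) (by simp [h0])
    (by
      filter_upwards [hfd, hrank] with x hx h3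
      rw [hx, hfd.self_of_nhds]
      have h1 := finrank_ker_starProjection_comp (fderiv ℝ g x) Tᗮ
      have h2 := finrank_ker_starProjection_comp (fderiv ℝ g a) Tᗮ
      omega)
    (by
      rw [hfd.self_of_nhds]
      change Tᗮ.starProjection (fderiv ℝ g a d) = 0
      rw [Submodule.starProjection_apply_eq_zero_iff]
      exact Submodule.le_orthogonal_orthogonal _ hd)
  refine ⟨x, hx, hx0, hxd, hxz.mono fun t ht => ?_⟩
  rwa [Submodule.starProjection_apply_eq_zero_iff, Submodule.orthogonal_orthogonal] at ht

end Rank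

/-! ### Curves along a face. -/

section CurveInFace

variable {n m k : ℕ}

theorem exists_curve_of_facialConstantRank {g : Vec n → SymMat k} {xbar d : Vec n}
    (hg : ContDiffAt ℝ 2 g xbar) (h0 : g xbar = 0) (hfcr : FacialConstantRank g xbar)
    (hd : fderiv ℝ g xbar d ∈ psdCone k) :
    ∃ x : ℝ → Vec n, ContDiffAt ℝ 2 x 0 ∧ x 0 = xbar ∧ deriv x 0 = d ∧
      ∀ᶠ t in 𝓝 0, (g (x t)).1 * kerProj (fderiv ℝ g xbar d) = 0 := by
  set Y := fderiv ℝ g xbar d with hY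
  -- The face must contain the velocity `Y`, yet force its whole span to vanish on `ker Y`.
  set F : Set (SymMat k) := psdCone k ∩ annihilator (kerProj Y) with hF
  have hspan : Submodule.span ℝ F ≤ annihilator (kerProj Y) :=
    Submodule.span_le.2 Set.inter_subset_right
  have hYF : Y ∈ F := ⟨hd, mul_kerProj Y⟩
  obtain ⟨V, hV, hrank⟩ := hfcr
  obtain ⟨x, hx, hx0, hxd, hxz⟩ := exists_curve_in_subspace hg h0 (Submodule.span ℝ F)
    (Filter.mem_of_superset hV fun x hx => hrank F (isFace_annihilator _) x hx)
    (Submodule.subset_span hYF)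
  exact ⟨x, hx, hx0, hxd, hxz.mono fun t ht => hspan ht⟩

end CurveInFace

/-! ### Feasibility of the curve. -/

section Feasible

variable {n m k : ℕ} {G : Vec n → SymMat m} {𝓔 : SymMat m → Matrix (Fin m) (Fin k) ℝ}

/-- `Z t / t + kerProj Y` tends to a positive definite matrix, and `hker` allows the projection to
be removed again. -/
theorem eventually_posSemidef_of_hasDerivAt {Z : ℝ → SymMat k} {Y : SymMat k}
    (hZ : HasDerivAt Z Y 0) (h0 : Z 0 = 0) (hY : Y ∈ psdCone k)
    (hker : ∀ᶠ t in 𝓝 0, (Z t).1 * kerProj Y = 0) : ∀ᶠ t in 𝓝[>] 0, Z t ∈ psdCone k := by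
  have hs : Tendsto (fun t : ℝ => t⁻¹ • (Z t).1 + kerProj Y) (𝓝[>] 0) (𝓝 (Y.1 + kerProj Y)) := by
    have h := (hasDerivAt_coe hZ).tendsto_slope_zero_right
    simp only [zero_add, h0] at h
    have h1 := h.add_const (kerProj Y)
    refine h1.congr fun t => ?_
    change t⁻¹ • ((Z t).1 - 0) + kerProj Y = _
    rw [sub_zero]
  filter_upwards [hs.eventually (eventually_posSemidef (posDef_add_kerProj hY)),
    hker.filter_mono nhdsWithin_le_nhds, self_mem_nhdsWithin] with t h1 h2 ht
  have ht' : (0 : ℝ) < t := ht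
  have hsym : (t⁻¹ • (Z t).1)ᵀ = t⁻¹ • (Z t).1 := (t⁻¹ • Z t).2
  have h3 : (t⁻¹ • (Z t).1).PosSemidef := by
    refine posSemidef_of_mul_eq_zero hsym (kerProj_transpose Y) (kerProj_mul_self Y) ?_ (h1 ?_)
    · rw [Matrix.smul_mul, h2, smul_zero]
    · rw [Matrix.transpose_add, hsym, kerProj_transpose]
  have h4 := h3.smul ht'.le
  rw [smul_smul, mul_inv_cancel₀ ht'.ne', one_smul] at h4
  exact h4

/-- `A + EEᵀ` is positive definite, hence so is its form nearby; thus only the low block of `B` can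
fail to be positive. -/
theorem eventually_posSemidef_of_compress {A : SymMat m} {r : ℕ} (hA : A ∈ psdCone m)
    (hker : IsOrthonormalBasisMatrix (𝓔 A) (LinearMap.ker (Matrix.toLin' A.1)))
    (hE : ContinuousAt 𝓔 A)
    (hlow : ∀ᶠ B in 𝓝 A, IsOrthonormalBasisMatrix (𝓔 B) (lowEigenspace B r)) :
    ∀ᶠ B in 𝓝 A, compress (𝓔 B) B ∈ psdCone k → B ∈ psdCone m := by
  have hc : ContinuousAt (fun B : SymMat m => B.1 + 𝓔 B * (𝓔 B)ᵀ) A := by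
    have h1 : ContinuousAt (fun B => (𝓔 B)ᵀ) A := (transposeL m k).continuous.continuousAt.comp hE
    have h2 : ContinuousAt (fun B => 𝓔 B * (𝓔 B)ᵀ) A :=
      isBoundedBilinearMap_matrix_mul.continuous.continuousAt.comp (hE.prodMk h1)
    exact (SymMat m).subtypeL.continuous.continuousAt.add h2
  filter_upwards [hlow, hc.eventually (eventually_posSemidef (posDef_add_kerFrame hker hA))]
    with B h1 h2 h3
  have hB : B.1ᵀ = B.1 := B.2
  refine posSemidef_of_invariant hB h1.1 (mul_frame_eq h1) h3 (h2 ?_)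
  rw [Matrix.transpose_add, Matrix.transpose_mul, Matrix.transpose_transpose, hB]

theorem mul_frame_mul_eq_zero {A : SymMat m} {r : ℕ} {E : Matrix (Fin m) (Fin k) ℝ}
    (hE : IsOrthonormalBasisMatrix E (lowEigenspace A r)) {Q : Matrix (Fin k) (Fin k) ℝ}
    (hQ : (compress E A).1 * Q = 0) : A.1 * (E * Q) = 0 := by
  rw [← Matrix.mul_assoc, mul_frame_eq hE, Matrix.mul_assoc,
    show Eᵀ * A.1 * E * Q = 0 from hQ, Matrix.mul_zero]

end Feasible

/-! ### Tangent cones. -/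

section TangentCones

variable {n m k : ℕ}

theorem isClosed_psdCone : IsClosed (psdCone m) := by
  have h : psdCone m = ⋂ x : Fin m → ℝ, {A : SymMat m | 0 ≤ x ⬝ᵥ A.1 *ᵥ x} := by
    ext A
    rw [Set.mem_iInter]
    constructor
    · exact fun h x => dotProduct_mulVec_nonneg h x
    · intro h
      refine Matrix.PosSemidef.of_dotProduct_mulVec_nonneg (symMat_isHermitian A) fun x => ?_
      simpa using h x
  rw [h]
  refine isClosed_iInter fun x => isClosed_le continuous_const ?_
  have hc : Continuous fun A : Matrix (Fin m) (Fin m) ℝ => x ⬝ᵥ A *ᵥ x :=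
    Continuous.dotProduct continuous_const (Continuous.matrix_mulVec continuous_id continuous_const)
  exact hc.comp (SymMat m).subtypeL.continuous

/-- `A ↦ Eᵀ A E` as a continuous linear map. -/
noncomputable def compressL (E : Matrix (Fin m) (Fin k) ℝ) : SymMat m →L[ℝ] SymMat k :=
  LinearMap.toContinuousLinearMap
    { toFun := compress E
      map_add' := fun A B => Subtype.ext (by
        change Eᵀ * (A.1 + B.1) * E = Eᵀ * A.1 * E + Eᵀ * B.1 * E
        rw [Matrix.mul_add, Matrix.add_mul])
      map_smul' := fun c A => Subtype.ext (by
        change Eᵀ * (c • A.1) * E = c • (Eᵀ * A.1 * E)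
        rw [Matrix.mul_smul, Matrix.smul_mul]) }

/-- Compression kills `A`, so each `Eᵀ vᵢ E` is positive semidefinite after division by `tᵢ`, and
the cone is closed. -/
theorem compress_mem_of_mem_tangentCone {A D : SymMat m} {E : Matrix (Fin m) (Fin k) ℝ}
    (hAE : A.1 * E = 0) (hD : D ∈ tangentCone (psdCone m) A) : compress E D ∈ psdCone k := by
  obtain ⟨t, v, ht, -, hv, hmem⟩ := hD
  have h1 : Tendsto (fun i => compressL E (v i)) atTop (𝓝 (compressL E D)) :=
    ((compressL E).continuous.tendsto D).comp hv
  refine isClosed_psdCone.mem_of_tendsto h1 (Eventually.of_forall fun i => ?_)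
  have h2 : (Eᵀ * (A.1 + t i • (v i).1) * E).PosSemidef :=
    posSemidef_transpose_mul_mul (hmem i) E
  have h3 : Eᵀ * (A.1 + t i • (v i).1) * E = t i • (Eᵀ * (v i).1 * E) := by
    rw [Matrix.mul_add, Matrix.add_mul, Matrix.mul_assoc _ A.1, hAE]
    simp
  rw [h3] at h2
  have h4 := h2.smul (inv_nonneg.2 (ht i).le)
  rw [smul_smul, inv_mul_cancel₀ (ht i).ne', one_smul] at h4
  exact h4

variable {X W : Type*} [NormedAddCommGroup X] [NormedAddCommGroup W] [InnerProductSpace ℝ X]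
  [InnerProductSpace ℝ W]

theorem fderiv_mem_tangentCone {g : X → W} {a d : X} {S : Set W} (hg : DifferentiableAt ℝ g a)
    (hd : d ∈ tangentCone {x | g x ∈ S} a) : fderiv ℝ g a d ∈ tangentCone S (g a) := by
  obtain ⟨t, v, ht, ht0, hv, hmem⟩ := hd
  refine ⟨t, fun i => (t i)⁻¹ • (g (a + t i • v i) - g a), ht, ht0, ?_, fun i => ?_⟩
  · refine (hasFDerivWithinAt_univ.2 hg.hasFDerivAt).lim (c := fun i => (t i)⁻¹)
      (d := fun i => t i • v i) ?_ (by simp) (hv.congr fun i => ?_)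
    · simpa using ht0.smul hv
    · rw [smul_smul, inv_mul_cancel₀ (ht i).ne', one_smul]
  · rw [smul_smul, mul_inv_cancel₀ (ht i).ne', one_smul, add_sub_cancel]
    exact hmem i

theorem mem_tangentCone_of_curve {S : Set X} {x : ℝ → X} {d : X} (hx : HasDerivAt x d 0)
    (hS : ∀ᶠ t in 𝓝[>] 0, x t ∈ S) : d ∈ tangentCone S (x 0) := by
  obtain ⟨ε, hε, hball⟩ := mem_nhdsGT_iff_exists_Ioc_subset.1 hS
  have hε' : (0 : ℝ) < ε := hε
  have ht : ∀ k : ℕ, 0 < ε / (k + 1) := fun k => by positivity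
  have ht0 : Tendsto (fun k : ℕ => ε / ((k : ℝ) + 1)) atTop (𝓝 0) :=
    tendsto_const_div_atTop_nhds_zero_nat ε |>.comp (tendsto_add_atTop_nat 1) |>.congr
      fun k => by simp
  refine ⟨fun k => ε / (k + 1), fun k => (ε / (k + 1))⁻¹ • (x (ε / (k + 1)) - x 0), ht, ht0, ?_,
    fun k => ?_⟩
  · have h := hx.tendsto_slope_zero_right
    simp only [zero_add] at h
    exact h.comp (tendsto_nhdsWithin_iff.2 ⟨ht0, Eventually.of_forall ht⟩)
  · rw [smul_smul, mul_inv_cancel₀ (ht k).ne', one_smul, add_sub_cancel]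
    exact hball ⟨ht k, div_le_self hε'.le (by linarith [k.cast_nonneg (α := ℝ)])⟩

end TangentCones

/-! ### Complementarity of multipliers. -/

section Multipliers

variable {m k : ℕ}

theorem mul_eq_zero_of_complementary {A lam : SymMat m} (hA : A ∈ psdCone m)
    (hlam : lam ∈ polarSet (psdCone m)) (h : inner ℝ A lam = 0) : A.1 * lam.1 = 0 := by
  have h1 : (A.1 * -lam.1).trace = 0 := by
    rw [Matrix.mul_neg, Matrix.trace_neg, ← inner_eq_trace, h, neg_zero]
  have h2 := mul_eq_zero_of_trace_mul hA (posSemidef_neg_of_mem_polarSet hlam) h1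
  rwa [Matrix.mul_neg, neg_eq_zero] at h2

/-- A multiplier that is orthogonal to the direction `D` is supported on the part of the kernel of
`A` on which the compression of `D` vanishes. -/
theorem eq_frame_conj {A D lam : SymMat m} {E : Matrix (Fin m) (Fin k) ℝ}
    (hE : IsOrthonormalBasisMatrix E (LinearMap.ker (Matrix.toLin' A.1)))
    (hAlam : A.1 * lam.1 = 0) (hlam : (-lam.1).PosSemidef) (hD : compress E D ∈ psdCone k)
    (h : inner ℝ D lam = 0) :
    lam.1 = E * kerProj (compress E D) * (Eᵀ * lam.1 * E) * (E * kerProj (compress E D))ᵀ := by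
  have hl : lam.1ᵀ = lam.1 := lam.2
  have h1 : E * Eᵀ * lam.1 = lam.1 := kerFrame_mul_transpose_mul hE hAlam
  have h2 : lam.1 * (E * Eᵀ) = lam.1 := by
    have h := congrArg Matrix.transpose h1
    simpa [Matrix.transpose_mul, hl] using h
  have h3 : E * (Eᵀ * lam.1 * E) * Eᵀ = lam.1 := by
    calc E * (Eᵀ * lam.1 * E) * Eᵀ = E * Eᵀ * lam.1 * (E * Eᵀ) := by
          simp only [Matrix.mul_assoc]
      _ = lam.1 := by rw [h1, h2]
  -- Second complementarity: the compressions of `D` and `-lam` are positive semidefinite with trace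
  -- product zero.
  have h4 : (compress E D).1 * (Eᵀ * lam.1 * E) = 0 := by
    have h5 : ((compress E D).1 * (Eᵀ * -lam.1 * E)).trace = 0 := by
      change (Eᵀ * D.1 * E * (Eᵀ * -lam.1 * E)).trace = 0
      have h6 : Eᵀ * D.1 * E * (Eᵀ * -lam.1 * E) = Eᵀ * (D.1 * E * (Eᵀ * -lam.1 * E)) := by
        simp only [Matrix.mul_assoc]
      have h7 : D.1 * E * (Eᵀ * -lam.1 * E) * Eᵀ = -(D.1 * (E * (Eᵀ * lam.1 * E) * Eᵀ)) := by
        simp only [Matrix.mul_assoc, Matrix.neg_mul, Matrix.mul_neg]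
      rw [h6, Matrix.trace_mul_comm, h7, h3, Matrix.trace_neg, ← inner_eq_trace, h, neg_zero]
    have h8 := mul_eq_zero_of_trace_mul hD (posSemidef_transpose_mul_mul hlam E) h5
    simpa [Matrix.mul_neg, Matrix.neg_mul] using h8
  have h9 : kerProj (compress E D) * (Eᵀ * lam.1 * E) = Eᵀ * lam.1 * E :=
    kerProj_mul_of_mul_eq_zero _ h4
  have h10 : Eᵀ * lam.1 * E * kerProj (compress E D) = Eᵀ * lam.1 * E := by
    have h := congrArg Matrix.transpose h9
    simpa [Matrix.transpose_mul, hl, kerProj_transpose, Matrix.mul_assoc] using h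
  calc lam.1 = E * (Eᵀ * lam.1 * E) * Eᵀ := h3.symm
    _ = E * (kerProj (compress E D) * (Eᵀ * lam.1 * E) * kerProj (compress E D)) * Eᵀ := by
        rw [h9, h10]
    _ = _ := by
        rw [Matrix.transpose_mul, kerProj_transpose]
        simp only [Matrix.mul_assoc]

end Multipliers

/-! ### The sigma-term. -/

section Sigma

variable {n m k : ℕ}

/-- The congruence by `1 - A†B` imitates a Schur complement. For `B = tD` it leaves the curvature
term of order `t²` and a term of order `t³`. -/
theorem trace_shifted {A : SymMat m} {M B : Matrix (Fin m) (Fin m) ℝ} (hMA : M * A.1 = 0)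
    (hAM : A.1 * M = 0) (hMB : (M * B).trace = 0) :
    (M * ((1 - B * pinv A) * (A.1 + B) * (1 - pinv A * B))).trace =
      -(M * (B * pinv A * B)).trace + (M * (B * pinv A * B * pinv A * B)).trace := by
  have hP := (pinv_penrose A).2.1
  set P := pinv A
  have h1 : M * ((1 - B * P) * (A.1 + B) * (1 - P * B)) =
      M * A.1 + M * B - M * A.1 * (P * B) - M * (B * P * B) - M * (B * P) * A.1 - M * (B * P * B)
        + M * (B * (P * A.1 * P) * B) + M * (B * P * B * P * B) := by
    noncomm_ring
  have h2 : (M * (B * P) * A.1).trace = 0 := by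
    rw [Matrix.trace_mul_comm, ← Matrix.mul_assoc, hAM, Matrix.zero_mul, Matrix.trace_zero]
  rw [h1, hP, hMA]
  simp only [Matrix.trace_add, Matrix.trace_sub, Matrix.trace_zero, Matrix.zero_mul, hMB, h2]
  ring

theorem trace_le_of_mem_secondTangentSet {A D w lam : SymMat m} (hAlam : A.1 * lam.1 = 0)
    (hlam : (-lam.1).PosSemidef) (hD : inner ℝ D lam = 0)
    (hw : w ∈ secondTangentSet (psdCone m) A D) :
    inner ℝ w lam ≤ 2 * (lam.1 * (D.1 * pinv A * D.1)).trace := by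
  obtain ⟨ρ, hρ, hmem⟩ := hw
  have hl : lam.1ᵀ = lam.1 := lam.2
  have hs : A.1ᵀ = A.1 := A.2
  have hDs : D.1ᵀ = D.1 := D.2
  set P := pinv A with hP
  set M := -lam.1 with hM
  have hAM : A.1 * M = 0 := by rw [hM, Matrix.mul_neg, hAlam, neg_zero]
  have hMA : M * A.1 = 0 := by
    have h := congrArg Matrix.transpose hAM
    simpa [Matrix.transpose_mul, hM, hl, hs] using h
  have hMD : (M * D.1).trace = 0 := by
    rw [hM, Matrix.neg_mul, Matrix.trace_neg, Matrix.trace_mul_comm, ← inner_eq_trace, hD, neg_zero]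
  -- The point of the cone is `A + tD + t² Z t`. Its shifted trace against `M ⪰ 0` is nonnegative;
  -- the limit after division by `t²` gives the bound.
  set Z : ℝ → Matrix (Fin m) (Fin m) ℝ := fun t => (1 / 2 : ℝ) • w.1 + (t ^ 2)⁻¹ • (ρ t).1 with hZ
  have hlim : Tendsto (fun t : ℝ => (M * ((1 - t • (D.1 * P)) * Z t * (1 - t • (P * D.1)))).trace -
      (M * (D.1 * P * D.1)).trace + t * (M * (D.1 * P * D.1 * P * D.1)).trace) (𝓝[>] 0)
      (𝓝 ((1 / 2) * (M * w.1).trace - (M * (D.1 * P * D.1)).trace)) := by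
    have hZl : Tendsto Z (𝓝[>] 0) (𝓝 ((1 / 2 : ℝ) • w.1)) := by
      have h1 : Tendsto (fun t : ℝ => (t ^ 2)⁻¹ • ρ t) (𝓝[>] 0) (𝓝 0) := hρ.tendsto_inv_smul_nhds_zero
      have h2 := ((SymMat m).subtypeL.continuous.tendsto 0).comp h1
      have h3 := h2.const_add ((1 / 2 : ℝ) • w.1)
      rw [map_zero, add_zero] at h3
      exact h3
    have hcont : Continuous fun p : ℝ × Matrix (Fin m) (Fin m) ℝ =>
        (M * ((1 - p.1 • (D.1 * P)) * p.2 * (1 - p.1 • (P * D.1)))).trace -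
      (M * (D.1 * P * D.1)).trace + p.1 * (M * (D.1 * P * D.1 * P * D.1)).trace := by
      fun_prop
    have h4 := (hcont.tendsto ((0 : ℝ), (1 / 2 : ℝ) • w.1)).comp
      ((tendsto_id.mono_left nhdsWithin_le_nhds).prodMk_nhds hZl)
    simpa using! h4
  have hnonneg := ge_of_tendsto hlim (by
    filter_upwards [self_mem_nhdsWithin] with t ht
    have ht' : (0 : ℝ) < t := ht
    have h1 := posSemidef_transpose_mul_mul (hmem t ht') (1 - P * (t • D.1))
    have h2 := trace_mul_nonneg hlam h1
    have h3 : (1 - P * (t • D.1))ᵀ = 1 - (t • D.1) * P := by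
      rw [Matrix.transpose_sub, Matrix.transpose_one, Matrix.transpose_mul, Matrix.transpose_smul,
        hDs, hP, pinv_transpose]
    have h4 : (A + t • D + (t ^ 2 / 2) • w + ρ t : SymMat m).1 = (A.1 + t • D.1) + t ^ 2 • Z t := by
      change A.1 + t • D.1 + (t ^ 2 / 2) • w.1 + (ρ t).1 = _
      rw [hZ, smul_add, smul_smul, smul_smul, mul_inv_cancel₀ (by positivity), one_smul, ← add_assoc]
      congr 3
      ring
    rw [h3, h4, Matrix.mul_add, Matrix.add_mul, Matrix.mul_add, Matrix.trace_add,
      trace_shifted hMA hAM (by rw [Matrix.mul_smul, Matrix.trace_smul, hMD, smul_zero])] at h2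
    simp only [Matrix.mul_smul, Matrix.smul_mul, Matrix.trace_smul, smul_smul, smul_eq_mul,
      ← hP] at h2
    have h5 : 0 < t ^ 2 := by positivity
    refine nonneg_of_mul_nonneg_right ?_ h5
    linarith)
  have e1 : (M * w.1).trace = -inner ℝ w lam := by
    rw [hM, Matrix.neg_mul, Matrix.trace_neg, Matrix.trace_mul_comm, inner_eq_trace]
  have e2 : (M * (D.1 * P * D.1)).trace = -(lam.1 * (D.1 * P * D.1)).trace := by
    rw [hM, Matrix.neg_mul, Matrix.trace_neg]
  rw [e1, e2] at hnonneg
  linarith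

theorem dotProduct_shapiroMatrix {G : Vec n → SymMat m} (xbar d : Vec n) (lam : SymMat m) :
    (d : Fin n → ℝ) ⬝ᵥ shapiroMatrix G xbar lam *ᵥ (d : Fin n → ℝ) =
      2 * (lam.1 * ((fderiv ℝ G xbar d).1 * pinv (G xbar) * (fderiv ℝ G xbar d).1)).trace := by
  have hd : (fderiv ℝ G xbar d).1 = ∑ i, d i • (partialDeriv G xbar i).1 := by
    have h1 : d = ∑ i, d i • EuclideanSpace.single i (1 : ℝ) := by
      ext j
      simp [Finset.sum_apply, Pi.single_apply]
    have h2 : fderiv ℝ G xbar d = ∑ i, d i • partialDeriv G xbar i := by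
      conv_lhs => rw [h1]
      rw [map_sum]
      exact Finset.sum_congr rfl fun i _ => map_smul _ _ _
    rw [h2]
    simp
  have hin : ∀ i j, inner ℝ ((partialDeriv G xbar i).1 * pinv (G xbar) *
      (partialDeriv G xbar j).1) lam.1 =
        (lam.1 * ((partialDeriv G xbar i).1 * pinv (G xbar) * (partialDeriv G xbar j).1)).trace := by
    intro i j
    have hl : lam.1ᵀ = lam.1 := lam.2
    rw [real_inner_comm]
    change (lam.1ᵀ * _).trace = _
    rw [hl]
  rw [hd]
  simp only [dotProduct, Matrix.mulVec, shapiroMatrix, Matrix.of_apply, hin, Finset.sum_mul,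
    Finset.mul_sum, Matrix.trace_sum, Matrix.smul_mul,
    Matrix.mul_smul, Matrix.trace_smul, smul_eq_mul]
  rw [Finset.sum_comm]
  refine Finset.sum_congr rfl fun i _ => Finset.sum_congr rfl fun j _ => ?_
  ring

/-- Second derivative of a curve `A` of symmetric matrices, compressed to the initial value of a
curve `V` in the kernel of `A`. -/
theorem transpose_mul_second_deriv {A : ℝ → SymMat m} {V : ℝ → Matrix (Fin m) (Fin k) ℝ}
    (hA : ContDiffAt ℝ 2 A 0) (hV : ContDiffAt ℝ 2 V 0) (hAV : ∀ᶠ t in 𝓝 0, (A t).1 * V t = 0) :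
    (V 0)ᵀ * (deriv (deriv A) 0).1 * V 0 =
      (2 : ℝ) • ((V 0)ᵀ * ((deriv A 0).1 * pinv (A 0) * (deriv A 0).1) * V 0) := by
  have hd1 : ∀ᶠ t in 𝓝 (0 : ℝ), (A t).1 * deriv V t + (deriv A t).1 * V t = 0 := by
    filter_upwards [hAV.eventually_nhds, eventually_differentiableAt hA,
      eventually_differentiableAt hV] with t h1 h2 h3
    exact (hasDerivAt_matrix_mul (hasDerivAt_coe h2.hasDerivAt) h3.hasDerivAt).unique
      ((hasDerivAt_const t 0).congr_of_eventuallyEq h1)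
  have h1 := hd1.self_of_nhds
  have h2 : (A 0).1 * deriv (deriv V) 0 + (deriv A 0).1 * deriv V 0 +
      ((deriv A 0).1 * deriv V 0 + (deriv (deriv A) 0).1 * V 0) = 0 :=
    ((hasDerivAt_matrix_mul (hasDerivAt_coe (hA.differentiableAt (by simp)).hasDerivAt)
      (differentiableAt_deriv hV).hasDerivAt).add
      (hasDerivAt_matrix_mul (hasDerivAt_coe (differentiableAt_deriv hA).hasDerivAt)
        (hV.differentiableAt (by simp)).hasDerivAt)).unique
      ((hasDerivAt_const 0 0).congr_of_eventuallyEq hd1)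
  have hs : (A 0).1ᵀ = (A 0).1 := (A 0).2
  have hs1 : (deriv A 0).1ᵀ = (deriv A 0).1 := (deriv A 0).2
  have hV0 : (V 0)ᵀ * (A 0).1 = 0 := by
    have h := congrArg Matrix.transpose hAV.self_of_nhds
    rwa [Matrix.transpose_mul, hs, Matrix.transpose_zero] at h
  set A0 := (A 0).1
  set A1 := (deriv A 0).1
  set A2 := (deriv (deriv A) 0).1
  set V1 := deriv V 0
  have h3 : A1 * V 0 = -(A0 * V1) := eq_neg_of_add_eq_zero_right h1
  have h4 : (V 0)ᵀ * A1 = -(V1ᵀ * A0) := by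
    have h := congrArg Matrix.transpose h3
    simpa [Matrix.transpose_mul, hs, hs1] using h
  -- The first derivative of `AV = 0` replaces `A1 * V 0` by `-(A0 * V1)`, and then `A0 A0† A0 =
  -- A0`.
  have h5 : (V 0)ᵀ * (A1 * pinv (A 0) * A1) * V 0 = -((V 0)ᵀ * A1 * V1) := by
    calc (V 0)ᵀ * (A1 * pinv (A 0) * A1) * V 0 = ((V 0)ᵀ * A1) * pinv (A 0) * (A1 * V 0) := by
          simp only [Matrix.mul_assoc]
      _ = V1ᵀ * (A0 * pinv (A 0) * A0) * V1 := by
          rw [h3, h4]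
          simp only [Matrix.mul_assoc, Matrix.neg_mul, Matrix.mul_neg, neg_neg]
      _ = -((V 0)ᵀ * A1 * V1) := by
          rw [(pinv_penrose (A 0)).1, h4, Matrix.neg_mul, neg_neg]
  have h6 := congrArg ((V 0)ᵀ * ·) h2
  simp only [Matrix.mul_add, ← Matrix.mul_assoc, hV0, Matrix.zero_mul, zero_add,
    Matrix.mul_zero] at h6
  rw [h5, two_smul]
  rw [← add_assoc] at h6
  rw [eq_neg_of_add_eq_zero_right h6, neg_add]

end Sigma

/-! ### Feasible curves and second-order conditions. -/

section Optimality

variable {n m : ℕ}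

/-- Under facial constant rank, every linearized feasible direction is the velocity of a feasible
curve whose images have, in their kernel, a smooth frame `V`. -/
theorem exists_feasible_curve {r : ℕ} {G : Vec n → SymMat m} (hG : ContDiff ℝ 2 G) {xbar : Vec n}
    (hfeas : xbar ∈ feasibleSet G) {Ebar : Matrix (Fin m) (Fin (m - r)) ℝ}
    {𝓔 : SymMat m → Matrix (Fin m) (Fin (m - r)) ℝ} (hE : IsEigenframe (G xbar) Ebar 𝓔)
    (hfcr : FacialConstantRank (reducedConstraint 𝓔 G) xbar) {d : Vec n}
    (hd : d ∈ linearizedCone G xbar) :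
    ∃ x : ℝ → Vec n, ContDiffAt ℝ 2 x 0 ∧ x 0 = xbar ∧ deriv x 0 = d ∧
      (∀ᶠ t in 𝓝[>] 0, x t ∈ feasibleSet G) ∧
      ∃ V : ℝ → Matrix (Fin m) (Fin (m - r)) ℝ, ContDiffAt ℝ 2 V 0 ∧
        V 0 = Ebar * kerProj (compress Ebar (fderiv ℝ G xbar d)) ∧
        ∀ᶠ t in 𝓝 0, (G (x t)).1 * V t = 0 := by
  have hb := hE.apply_base
  have hker : IsOrthonormalBasisMatrix (𝓔 (G xbar))
      (LinearMap.ker (Matrix.toLin' (G xbar).1)) := hb ▸ hE.basis_ker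
  have h0 : (G xbar).1 * 𝓔 (G xbar) = 0 := mul_kerFrame_eq_zero hker
  have hgC := contDiffAt_reducedConstraint hG hE.analyticAt
  have hg0 : reducedConstraint 𝓔 G xbar = 0 := by
    apply Subtype.ext
    change (𝓔 (G xbar))ᵀ * (G xbar).1 * 𝓔 (G xbar) = 0
    rw [Matrix.mul_assoc, h0, Matrix.mul_zero]
  have hgd := fderiv_reducedConstraint hG hE.analyticAt h0 d
  have hpsd : fderiv ℝ (reducedConstraint 𝓔 G) xbar d ∈ psdCone (m - r) := by
    rw [hgd]
    exact compress_mem_of_mem_tangentCone h0 hd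
  obtain ⟨x, hx, hx0, hxd, hxQ⟩ := exists_curve_of_facialConstantRank hgC hg0 hfcr hpsd
  have hA : ContDiffAt ℝ 2 (fun t => G (x t)) 0 := hG.contDiffAt.comp 0 hx
  have hAt : Tendsto (fun t => G (x t)) (𝓝 0) (𝓝 (G xbar)) := hx0 ▸ hA.continuousAt.tendsto
  refine ⟨x, hx, hx0, hxd, ?_,
    fun t => 𝓔 (G (x t)) * kerProj (fderiv ℝ (reducedConstraint 𝓔 G) xbar d), ?_, ?_, ?_⟩
  · have hZ : HasDerivAt (fun t => reducedConstraint 𝓔 G (x t))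
        (fderiv ℝ (reducedConstraint 𝓔 G) xbar d) 0 := by
      have h1 : HasFDerivAt (reducedConstraint 𝓔 G) (fderiv ℝ (reducedConstraint 𝓔 G) xbar)
          (x 0) := by
        rw [hx0]
        exact (hgC.differentiableAt (by simp)).hasFDerivAt
      have h2 := (hx.differentiableAt (by simp)).hasDerivAt
      rw [hxd] at h2
      exact h1.comp_hasDerivAt (0 : ℝ) h2
    have hfe := eventually_posSemidef_of_compress hfeas hker hE.analyticAt.continuousAt hE.basis_low
    filter_upwards [eventually_posSemidef_of_hasDerivAt hZ (by rw [hx0, hg0]) hpsd hxQ,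
      (hAt.eventually hfe).filter_mono nhdsWithin_le_nhds] with t h1 h2
    exact h2 h1
  · have h1 : ContDiffAt ℝ 2 (fun t => 𝓔 (G (x t))) 0 := by
      have h2 : ContDiffAt ℝ 2 𝓔 (G (x 0)) := by
        rw [hx0]
        exact hE.analyticAt.contDiffAt
      exact h2.comp (0 : ℝ) hA
    exact contDiffAt_matrix_mul h1 contDiffAt_const
  · change 𝓔 (G (x 0)) * _ = _
    rw [hx0, hgd, hb]
  · filter_upwards [hxQ, hAt.eventually hE.basis_low] with t h1 h2
    exact mul_frame_mul_eq_zero h2 h1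

theorem deriv_deriv_nonneg_of_eventually_le {g : ℝ → ℝ} (hg : ContDiffAt ℝ 2 g 0)
    (h1 : deriv g 0 = 0) (hmin : ∀ᶠ t in 𝓝[>] 0, g 0 ≤ g t) : 0 ≤ deriv (deriv g) 0 := by
  have h := (taylor_two_isLittleO hg).mono (nhdsWithin_le_nhds (s := Set.Ioi 0))
  have h2 := h.tendsto_inv_smul_nhds_zero.add_const (deriv (deriv g) 0 / 2)
  rw [zero_add] at h2
  have h3 := ge_of_tendsto h2 (b := 0) (by
    filter_upwards [hmin, self_mem_nhdsWithin] with t ht ht0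
    have ht' : (0 : ℝ) < t := ht0
    have e : (t ^ 2)⁻¹ • (g t - (g 0 + t • deriv g 0 + (t ^ 2 / 2) • deriv (deriv g) 0)) +
        deriv (deriv g) 0 / 2 = (t ^ 2)⁻¹ * (g t - g 0) := by
      rw [h1]
      simp only [smul_eq_mul]
      field_simp
      ring
    rw [e]
    exact mul_nonneg (by positivity) (by linarith))
  linarith

theorem deriv_deriv_mem_secondTangentSet {E : Type*} [NormedAddCommGroup E]
    [InnerProductSpace ℝ E] {S : Set E} {A : ℝ → E} (hA : ContDiffAt ℝ 2 A 0) (h0 : A 0 ∈ S)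
    (hS : ∀ᶠ t in 𝓝[>] 0, A t ∈ S) :
    deriv (deriv A) 0 ∈ secondTangentSet S (A 0) (deriv A 0) := by
  classical
  -- Membership is demanded for every `t > 0`, so where `A t` leaves `S` the remainder is chosen to
  -- land on `A 0`; near `0` it is the Taylor remainder.
  refine ⟨fun t => (if A t ∈ S then A t else A 0) -
    (A 0 + t • deriv A 0 + (t ^ 2 / 2) • deriv (deriv A) 0), ?_, fun t _ => ?_⟩
  · refine ((taylor_two_isLittleO hA).mono nhdsWithin_le_nhds).congr' ?_ EventuallyEq.rfl
    filter_upwards [hS] with t ht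
    rw [if_pos ht]
  · rw [add_sub_cancel]
    split_ifs with h
    exacts [h, h0]

theorem inner_gradient (f : Vec n → ℝ) (x v : Vec n) :
    inner ℝ (gradient f x) v = fderiv ℝ f x v := by
  rw [gradient, InnerProductSpace.toDual_symm_apply]

theorem fderiv_eq_neg_inner {f : Vec n → ℝ} {G : Vec n → SymMat m} {xbar : Vec n} {lam : SymMat m}
    (hlam : lam ∈ multipliers f G xbar) (v : Vec n) :
    fderiv ℝ f xbar v = -inner ℝ (fderiv ℝ G xbar v) lam := by
  have h1 : inner ℝ (derivAdjoint G xbar lam) v = inner ℝ lam (fderiv ℝ G xbar v) :=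
    LinearMap.adjoint_inner_left (fderiv ℝ G xbar : Vec n →ₗ[ℝ] SymMat m) v lam
  rw [← inner_gradient, eq_neg_of_add_eq_zero_left hlam.2.1, inner_neg_left, h1, real_inner_comm]

end Optimality

end NSDP

/-! ### The main theorem. -/

theorem mainTheorem2 {n m r : ℕ}
    (f : NSDP.Vec n → ℝ) (G : NSDP.Vec n → NSDP.SymMat m)
    (hf : ContDiff ℝ 2 f) (hG : ContDiff ℝ 2 G)
    (xbar : NSDP.Vec n)
    (hfeas : xbar ∈ NSDP.feasibleSet G)
    (hmin : IsLocalMinOn f (NSDP.feasibleSet G) xbar)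
    (hr : (G xbar).1.rank = r)
    (Ebar : Matrix (Fin m) (Fin (m - r)) ℝ)
    (𝓔 : NSDP.SymMat m → Matrix (Fin m) (Fin (m - r)) ℝ)
    (hE : NSDP.IsEigenframe (G xbar) Ebar 𝓔)
    (hfcr : NSDP.FacialConstantRank (NSDP.reducedConstraint 𝓔 G) xbar) :
    NSDP.criticalCone f G xbar =
        NSDP.linearizedCone G xbar ∩ {d | inner ℝ (gradient f xbar) d = 0} ∧
      ∀ lam ∈ NSDP.multipliers f G xbar, ∀ d ∈ NSDP.criticalCone f G xbar,
        NSDP.sigmaTerm G d xbar lam =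
            (((d : Fin n → ℝ) ⬝ᵥ NSDP.shapiroMatrix G xbar lam *ᵥ (d : Fin n → ℝ) : ℝ) : EReal) ∧
          0 ≤ NSDP.secondDeriv f xbar d + inner ℝ (NSDP.secondDeriv G xbar d) lam -
            (d : Fin n → ℝ) ⬝ᵥ NSDP.shapiroMatrix G xbar lam *ᵥ (d : Fin n → ℝ) := by
  have hsub : NSDP.tangentCone (NSDP.feasibleSet G) xbar ⊆ NSDP.linearizedCone G xbar :=
    fun d hd => NSDP.fderiv_mem_tangentCone (hG.differentiable (by simp) xbar) hd
  refine ⟨?_, fun lam hlam d hd => ?_⟩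
  · ext d
    refine ⟨fun hd => ⟨hsub hd.1, hd.2⟩, fun hd => ⟨?_, hd.2⟩⟩
    obtain ⟨x, hx, hx0, hxd, hxf, -⟩ := NSDP.exists_feasible_curve hG hfeas hE hfcr hd.1
    have h := NSDP.mem_tangentCone_of_curve (hx.differentiableAt (by simp)).hasDerivAt hxf
    rwa [hx0, hxd] at h
  · obtain ⟨x, hx, hx0, hxd, hxf, V, hV, hV0, hAV⟩ :=
      NSDP.exists_feasible_curve hG hfeas hE hfcr (hsub hd.1)
    set D := fderiv ℝ G xbar d with hD
    have hA : ContDiffAt ℝ 2 (fun t => G (x t)) 0 := hG.contDiffAt.comp 0 hx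
    have hA1 : deriv (fun t => G (x t)) 0 = D := by
      have h := (NSDP.deriv_comp_curve hG (hx.differentiableAt (by simp))).deriv
      rw [hx0, hxd] at h
      exact h
    have hfd : fderiv ℝ f xbar d = 0 := by rw [← NSDP.inner_gradient]; exact hd.2
    have hDlam : inner ℝ D lam = 0 := by
      rw [NSDP.fderiv_eq_neg_inner hlam, neg_eq_zero] at hfd
      exact hfd
    have hneg := NSDP.posSemidef_neg_of_mem_polarSet hlam.1
    have hAlam := NSDP.mul_eq_zero_of_complementary hfeas hlam.1 hlam.2.2
    set w := deriv (deriv fun t => G (x t)) 0 with hw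
    have hwT : w ∈ NSDP.secondTangentSet (NSDP.psdCone m) (G xbar) D := by
      have h : w ∈ NSDP.secondTangentSet (NSDP.psdCone m) (G (x 0)) (deriv (fun t => G (x t)) 0) :=
        NSDP.deriv_deriv_mem_secondTangentSet hA (by rw [hx0]; exact hfeas) hxf
      rwa [hA1, hx0] at h
    have hwlam : inner ℝ w lam = 2 * (lam.1 * (D.1 * NSDP.pinv (G xbar) * D.1)).trace := by
      have h1 := NSDP.transpose_mul_second_deriv hA hV hAV
      simp only [hA1, hx0] at h1
      have h2 := NSDP.eq_frame_conj hE.basis_ker hAlam hneg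
        (NSDP.compress_mem_of_mem_tangentCone (NSDP.mul_kerFrame_eq_zero hE.basis_ker) (hsub hd.1))
        hDlam
      rw [← hD, ← hV0] at h2
      -- Since `lam = V₀ (Ebarᵀ lam Ebar) V₀ᵀ` with `V₀ = V 0`, pairing with `lam` sees only `V₀ᵀ B
      -- V₀`, where the second derivative is known.
      have h3 : ∀ B : Matrix (Fin m) (Fin m) ℝ,
          (lam.1 * B).trace = (Ebarᵀ * lam.1 * Ebar * ((V 0)ᵀ * B * V 0)).trace := by
        intro B
        conv_lhs => rw [h2]
        rw [Matrix.mul_assoc, Matrix.mul_assoc, Matrix.trace_mul_comm]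
        simp only [Matrix.mul_assoc]
      rw [NSDP.inner_eq_trace, Matrix.trace_mul_comm, h3, h1, h3 (D.1 * _ * _), Matrix.mul_smul,
        Matrix.trace_smul, smul_eq_mul]
    rw [NSDP.dotProduct_shapiroMatrix, ← hD, ← hwlam]
    refine ⟨le_antisymm (iSup₂_le fun v hv => ?_) (le_iSup₂_of_le w hwT le_rfl), ?_⟩
    · rw [EReal.coe_le_coe_iff, hwlam]
      exact NSDP.trace_le_of_mem_secondTangentSet hAlam hneg hDlam hv
    · have hfC : ContDiffAt ℝ 2 (fun t => f (x t)) 0 := hf.contDiffAt.comp 0 hx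
      have hf1 : deriv (fun t => f (x t)) 0 = 0 := by
        rw [(NSDP.deriv_comp_curve hf (hx.differentiableAt (by simp))).deriv, hx0, hxd, hfd]
      have hxt : Tendsto x (𝓝[>] 0) (𝓝[NSDP.feasibleSet G] xbar) :=
        tendsto_nhdsWithin_iff.2
          ⟨(hx0 ▸ hx.continuousAt.tendsto).mono_left nhdsWithin_le_nhds, hxf⟩
      have hf2 := NSDP.deriv_deriv_nonneg_of_eventually_le hfC hf1
        (by rw [hx0]; exact hxt.eventually hmin)
      rw [NSDP.deriv_deriv_comp_curve hf hx, hx0, hxd, NSDP.fderiv_eq_neg_inner hlam] at hf2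
      -- The unknown acceleration `x''` enters `w` and the second derivative of `f(x t)` through the
      -- same pairing with `lam`, so it can be eliminated.
      have hw2 : w = NSDP.secondDeriv G xbar d + fderiv ℝ G xbar (deriv (deriv x) 0) := by
        have h := NSDP.deriv_deriv_comp_curve hG hx
        rw [hx0, hxd] at h
        exact h
      rw [hw2, inner_add_left]
      simp only [NSDP.secondDeriv]
      linarith
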